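/- **Setting.** Let $\mathrm{fin}_2(\mathcal P)$ be the set of multisets of size 2 of elements of $\mathcal P$, and let $\mathbb N=\{1,2,\dots\}$. A *binary interaction process* is a map $\mathcal I:\mathbb N\to\mathrm{fin}_2(\mathcal P)$ with $\mathcal P$ countable (without loss of generality $\mathcal P=\mathbb Z$). Two such processes $\mathcal I,\mathcal I'$ induce the same *edge-labeled network* $\mathcal E_{\mathcal I}=\mathcal E_{\mathcal I'}$ if there is a bijection $\rho$ from the set of vertices occurring in $\mathcal I$ onto the set of vertices occurring in $\mathcal I'$ such that $\mathcal I'(n)=\rho(\mathcal I(n))$ for all $n$. The set $\mathfrak E_{\mathbb N}$ of binary edge-labeled networks carries the product-discrete topology (the coarsest topology making all restrictions $\mathcal E\mapsto\mathcal E|_{[n]}$ to the first $n$ edges continuous for the discrete topology) and its Borel $\sigma$-field. For a permutation $\sigma$ of $\mathbb N$, $\mathcal E_{\mathcal I}^\sigma$ is the network induced by $n\mapsto\mathcal I(\sigma^{-1}(n))$. A random element $\mathcal Y$ of $\mathfrak E_{\mathbb N}$ is *edge exchangeable* if $\mathcal Y^\sigma$ and $\mathcal Y$ have the same distribution for every permutation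 $\sigma$ of $\mathbb N$. **The simplex.** The $\mathrm{fin}_2(\mathbb N)$-simplex is the set of all $f=(f_{i,j})_{j\ge i\ge -1}$ with $f_{i,j}\ge 0$, $f_{-1,i}=0$ for all $i\ne 0$ and $\sum_{j\ge i\ge-1}f_{i,j}=1$, with the metric $d(f,f')=\sum_{j\ge i\ge -1}|f_{i,j}-f'_{i,j}|$ and its Borel $\sigma$-field. Put $f_{j,i}=f_{i,j}$, and for $i\ge1$ put $f_\bullet^{(i)}=\sum_{j\ge0}f_{i,j}$ and $A_f=\{i\ge1:f_\bullet^{(i)}>0\}$. Call $g$ a *reordering* of $f$ if there is a bijection $\pi:A_f\to A_g$ such that, with $\pi(-1)=-1$ and $\pi(0)=0$, $g_{\pi(i),\pi(j)}=f_{i,j}$ for all $i,j\in A_f\cup\{-1,0\}$. Call $f$ *ranked* if $f_\bullet^{(i)}\ge f_\bullet^{(i+1)}$ for all $i\ge1$. Let $\mathcal F^\downarrow$ be the space of rank-reordered elements, with ties broken lexicographically: the set of ranked $f$ such that no ranked reordering $g$ of $f$ comes before $f$, where $g$ comes before $f$ if at the first pair in the list $(1,1),(1,2),(2,2),(1,3),(2,3),(3,3),\dots$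 at which they differ, $g$ has the larger entry. $\mathcal F^\downarrow$ carries the trace $\sigma$-field. **The network generated by $f$.** Given $f$ in the simplex, let $X_1,X_2,\dots$ be i.i.d. with $\mathrm{pr}(X_k=\{i,j\})=f_{i,j}$, $j\ge i\ge-1$. Put $m_0=0$, and for $n\ge1$ let $z=m_{n-1}$. If $0\notin X_n$, put $\mathcal X(n)=X_n$, $m_n=z$; if $X_n=\{0,j\}$ with $j\ge1$, put $\mathcal X(n)=\{z-1,j\}$, $m_n=z-1$; if $X_n=\{0,0\}$, put $\mathcal X(n)=\{z-1,z-1\}$, $m_n=z-1$; if $X_n=\{-1,0\}$, put $\mathcal X(n)=\{z-1,z-2\}$, $m_n=z-2$. Let $\epsilon_f$ be the distribution of $\mathcal E_{\mathcal X}$. (Thus the special labels $-1$ and $0$ account for "blips", that is, vertices which occur in one edge only.) **Theorem A.2 (Supplement).** Let $\mathcal Y$ be an edge exchangeable random binary edge-labeled network in $\mathfrak E_{\mathbb N}$. Then there exists a unique probability measure $\phi$ on $\mathcal F^\downarrow$ such that $\mathcal Y\sim\epsilon_\phi$, where $$\epsilon_\phi(\cdot)=\int_{\mathcal F^\downarrow}\epsilon_f(\cdot)\,\phi(df).$$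 -/

import Mathlib

open MeasureTheory Set

namespace EdgeExch

/-! ### Edge-labeled networks

Vertices are taken from the countably infinite population `ℤ`.  The edge labels `1, 2, 3, …` are
represented by the natural numbers `0, 1, 2, …`, and `{1, …, n}` by `Fin n`. -/

/-- A binary interaction process: each edge label in `S` is sent to a multiset of two vertices. -/
abbrev Interactions (S : Type) : Type := S → Sym2 ℤ

/-- The vertices that take part in at least one interaction of the process. -/
def Interactions.vertices {S : Type} (I : Interactions S) : Set ℤ := {v | ∃ n, v ∈ I n}

/-- Two processes induce the same edge-labeled network when a bijection between the vertices that
occur in them carries one to the other. -/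
def SameNetwork {S : Type} (I J : Interactions S) : Prop :=
  ∃ ρ : ℤ → ℤ, InjOn ρ I.vertices ∧ ∀ n, J n = (I n).map ρ

theorem SameNetwork.refl {S : Type} (I : Interactions S) : SameNetwork I I :=
  ⟨id, injOn_id _, fun n => by simp⟩

theorem SameNetwork.symm {S : Type} {I J : Interactions S} (h : SameNetwork I J) :
    SameNetwork J I := by
  obtain ⟨ρ, hρ, hJ⟩ := h
  have hinv : ∀ v ∈ I.vertices, Function.invFunOn ρ I.vertices (ρ v) = v :=
    fun v hv => hρ.leftInvOn_invFunOn hv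
  refine ⟨Function.invFunOn ρ I.vertices, ?_, fun n => ?_⟩
  · rintro a ⟨n, ha⟩ b ⟨m, hb⟩ hab
    rw [hJ, Sym2.mem_map] at ha hb
    obtain ⟨a', ha', rfl⟩ := ha
    obtain ⟨b', hb', rfl⟩ := hb
    rw [hinv _ ⟨n, ha'⟩, hinv _ ⟨m, hb'⟩] at hab
    rw [hab]
  · rw [hJ, Sym2.map_map]
    have h := Sym2.map_congr (s := I n) (f := Function.invFunOn ρ I.vertices ∘ ρ) (g := id)
      fun v hv => hinv v ⟨n, hv⟩
    rw [h, Sym2.map_id, id]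

theorem SameNetwork.trans {S : Type} {I J K : Interactions S} (h : SameNetwork I J)
    (h' : SameNetwork J K) : SameNetwork I K := by
  obtain ⟨ρ, hρ, hJ⟩ := h
  obtain ⟨τ, hτ, hK⟩ := h'
  have hmem : ∀ v ∈ I.vertices, ρ v ∈ J.vertices := by
    rintro v ⟨n, hv⟩
    exact ⟨n, by rw [hJ, Sym2.mem_map]; exact ⟨v, hv, rfl⟩⟩
  refine ⟨τ ∘ ρ, hτ.comp hρ hmem, fun n => ?_⟩
  rw [hK, hJ, Sym2.map_map]

theorem SameNetwork.comp {S T : Type} (g : T → S) {I J : Interactions S} (h : SameNetwork I J) :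
    SameNetwork (I ∘ g) (J ∘ g) := by
  obtain ⟨ρ, hρ, hJ⟩ := h
  refine ⟨ρ, hρ.mono ?_, fun n => hJ (g n)⟩
  rintro v ⟨n, hv⟩
  exact ⟨g n, hv⟩

instance processSetoid (S : Type) : Setoid (Interactions S) where
  r := SameNetwork
  iseqv := ⟨SameNetwork.refl, SameNetwork.symm, SameNetwork.trans⟩

/-- Binary edge-labeled networks with edges labeled by `S`. -/
def Network (S : Type) : Type := Quotient (processSetoid S)

/-- The edge-labeled network induced by an interaction process. -/
def inducedNetwork {S : Type} (I : Interactions S) : Network S := Quotient.mk _ I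

/-- The network whose edge labeled `t` is the edge of `E` labeled `g t`. -/
def Network.pullback {S T : Type} (g : T → S) (E : Network S) : Network T :=
  Quotient.map (fun I : Interactions S => (I ∘ g : Interactions T)) (fun _ _ h => SameNetwork.comp g h) E

/-- The network `E ^ σ`, in which the edge labeled `i` is the edge of `E` labeled `σ⁻¹ i`. -/
def Network.relabel {S : Type} (σ : Equiv.Perm S) (E : Network S) : Network S :=
  E.pullback σ.symm

/-- The restriction of a network to its first `n` edges. -/
def Network.restrict (n : ℕ) (E : Network ℕ) : Network (Fin n) :=
  E.pullback Fin.val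

instance (n : ℕ) : TopologicalSpace (Network (Fin n)) := ⊥

instance (n : ℕ) : DiscreteTopology (Network (Fin n)) := ⟨rfl⟩

/-- The product-discrete topology: the coarsest topology that makes all restrictions to finitely
many edges continuous. -/
instance : TopologicalSpace (Network ℕ) :=
  TopologicalSpace.induced (fun (E : Network ℕ) (n : ℕ) => E.restrict n) inferInstance

instance : MeasurableSpace (Network ℕ) := borel _

instance : BorelSpace (Network ℕ) := ⟨rfl⟩

instance (n : ℕ) : Countable (Network (Fin n)) :=
  inferInstanceAs (Countable (Quotient (processSetoid (Fin n))))

/-- The Borel sets of networks are generated by the restrictions to finitely many edges. -/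
theorem network_measurableSpace_eq :
    (inferInstance : MeasurableSpace (Network ℕ)) =
      ⨆ n, MeasurableSpace.comap (Network.restrict n) ⊤ := by
  let _ : ∀ n, MeasurableSpace (Network (Fin n)) := fun _ => ⊤
  have _ : ∀ n, BorelSpace (Network (Fin n)) := fun n => ⟨borel_eq_top_of_discrete.symm⟩
  have h : (inferInstance : MeasurableSpace (Network ℕ)) =
      MeasurableSpace.comap (fun (E : Network ℕ) (n : ℕ) => E.restrict n)
        (borel (∀ n, Network (Fin n))) := borel_comap
  rw [h, ← BorelSpace.measurable_eq (α := ∀ n, Network (Fin n))]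
  simp only [MeasurableSpace.pi, MeasurableSpace.comap_iSup, MeasurableSpace.comap_comp]
  rfl

/-- A random edge-labeled network is edge exchangeable if relabeling its edges by any permutation
does not change its distribution. -/
def EdgeExchangeable {Ω : Type*} [MeasurableSpace Ω] (P : Measure Ω) (Y : Ω → Network ℕ) : Prop :=
  ∀ σ : Equiv.Perm ℕ, P.map (fun ω => (Y ω).relabel σ) = P.map Y

/-! ### The simplex of pair frequencies -/

/-- The `fin₂(ℕ)`-simplex: families `(f_{i,j})`, `j ≥ i ≥ -1`, of nonnegative reals with sum `1`
such that `f_{-1,i} = 0` for `i ≠ 0`, extended by `0` to the pairs with a label below `-1`. -/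
@[ext]
structure PairSimplex where
  /-- the mass of an unordered pair of labels -/
  mass : Sym2 ℤ → ℝ
  nonneg : ∀ s, 0 ≤ mass s
  label_ge : ∀ s, ∀ i ∈ s, i < -1 → mass s = 0
  neg_one : ∀ i : ℤ, i ≠ 0 → mass s(-1, i) = 0
  hasSum_one : HasSum mass 1

namespace PairSimplex

theorem summable_abs_sub (f g : PairSimplex) : Summable fun s => |f.mass s - g.mass s| :=
  (f.hasSum_one.summable.sub g.hasSum_one.summable).abs

/-- The simplex carries the `ℓ¹` distance. -/
noncomputable instance : MetricSpace PairSimplex where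
  dist f g := ∑' s, |f.mass s - g.mass s|
  dist_self f := by simp
  dist_comm f g := by simp only [abs_sub_comm]
  dist_triangle f g h := by
    rw [← (summable_abs_sub f g).tsum_add (summable_abs_sub g h)]
    exact (summable_abs_sub f h).tsum_le_tsum (fun s => abs_sub_le _ _ _)
      ((summable_abs_sub f g).add (summable_abs_sub g h))
  eq_of_dist_eq_zero := by
    intro f g h
    have h' := (summable_abs_sub f g).hasSum
    change HasSum _ (∑' s, |f.mass s - g.mass s|) at h'
    rw [show ∑' s, |f.mass s - g.mass s| = 0 from h,
      hasSum_zero_iff_of_nonneg (fun s => abs_nonneg _)] at h'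
    ext s
    exact sub_eq_zero.1 (abs_eq_zero.1 (congrFun h' s))

theorem dist_eq (f g : PairSimplex) : dist f g = ∑' s, |f.mass s - g.mass s| := rfl

noncomputable instance : MeasurableSpace PairSimplex := borel _

instance : BorelSpace PairSimplex := ⟨rfl⟩

theorem continuous_mass : Continuous (mass : PairSimplex → Sym2 ℤ → ℝ) := by
  refine continuous_pi fun s => ?_
  refine LipschitzWith.continuous (K := 1) (LipschitzWith.of_dist_le_mul fun f g => ?_)
  rw [NNReal.coe_one, one_mul, dist_eq, Real.dist_eq]
  exact (summable_abs_sub f g).le_tsum s fun _ _ => abs_nonneg _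

/-- On the simplex the `ℓ¹` distance induces the topology of pointwise convergence. -/
theorem isInducing_mass : Topology.IsInducing (mass : PairSimplex → Sym2 ℤ → ℝ) := by
  rw [Topology.isInducing_iff_nhds]
  intro f
  refine le_antisymm (continuous_mass.tendsto f).le_comap ?_
  change Filter.Tendsto id (Filter.comap mass (nhds f.mass)) (nhds f)
  rw [tendsto_iff_dist_tendsto_zero]
  have hd : ∀ g : PairSimplex, dist (id g) f = 2 * ∑' s, max (f.mass s - g.mass s) 0 := by
    intro g
    have ha : HasSum (fun s => f.mass s - g.mass s) 0 := by
      simpa using f.hasSum_one.sub g.hasSum_one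
    have hb := (summable_abs_sub f g).hasSum
    have hc : HasSum (fun s => max (f.mass s - g.mass s) 0)
        ((0 + ∑' s, |f.mass s - g.mass s|) / 2) := by
      have he : (fun s => max (f.mass s - g.mass s) 0) =
          fun s => (f.mass s - g.mass s + |f.mass s - g.mass s|) / 2 := by
        funext s
        rcases le_total 0 (f.mass s - g.mass s) with h | h
        · rw [max_eq_left h, abs_of_nonneg h]; ring
        · rw [max_eq_right h, abs_of_nonpos h]; ring
      rw [he]
      exact (ha.add hb).div_const 2
    rw [hc.tsum_eq, dist_comm, dist_eq]
    simp only [id]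
    ring
  simp only [hd]
  suffices h : Filter.Tendsto (fun g : PairSimplex => ∑' s, max (f.mass s - g.mass s) 0)
      (Filter.comap mass (nhds f.mass)) (nhds (∑' _ : Sym2 ℤ, (0 : ℝ))) by
    simpa using h.const_mul 2
  refine tendsto_tsum_of_dominated_convergence
    f.hasSum_one.summable (fun s => ?_) (Filter.Eventually.of_forall fun g s => ?_)
  · have hs : Filter.Tendsto (fun g : PairSimplex => g.mass s)
        (Filter.comap mass (nhds f.mass)) (nhds (f.mass s)) :=
      ((continuous_apply s).tendsto f.mass).comp Filter.tendsto_comap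
    simpa using ((tendsto_const_nhds (x := f.mass s)).sub hs).max (tendsto_const_nhds (x := (0 : ℝ)))
  · rw [Real.norm_of_nonneg (le_max_right _ _)]
    exact max_le (by linarith [g.nonneg s]) (f.nonneg s)

/-- The Borel sets of the simplex are generated by the coordinates. -/
theorem measurableSpace_eq :
    (inferInstance : MeasurableSpace PairSimplex) = MeasurableSpace.comap mass inferInstance := by
  have h : (inferInstance : MeasurableSpace PairSimplex) = borel PairSimplex := rfl
  rw [h, isInducing_mass.eq_induced, borel_comap, ← BorelSpace.measurable_eq]

/-- The total mass `∑_{j ≥ 0} f_{i,j}` of the pairs that involve the label `i ≥ 1`. -/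
noncomputable def degree (f : PairSimplex) (i : ℤ) : ℝ := ∑' j : ℕ, f.mass s(i, (j : ℤ))

/-- The labels `i ≥ 1` that occur with positive frequency. -/
def active (f : PairSimplex) : Set ℤ := {i | 1 ≤ i ∧ 0 < f.degree i}

/-- `g` is obtained from `f` by renaming the active labels among `1, 2, …`; the labels `-1` and
`0` keep their meaning. -/
def IsReordering (f g : PairSimplex) : Prop :=
  ∃ ρ : ℤ → ℤ, ρ (-1) = -1 ∧ ρ 0 = 0 ∧ BijOn ρ f.active g.active ∧
    ∀ s : Sym2 ℤ, (∀ i ∈ s, i = -1 ∨ i = 0 ∨ i ∈ f.active) → g.mass (s.map ρ) = f.mass s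

/-- The labels `1, 2, …` are in order of nonincreasing total mass. -/
def IsRanked (f : PairSimplex) : Prop := ∀ i : ℤ, 1 ≤ i → f.degree (i + 1) ≤ f.degree i

/-- `f` comes before `g` in the lexicographic ordering: at the first place where they differ in
the list `(1,1), (1,2), (2,2), (1,3), (2,3), (3,3), …` of pairs, `f` has the larger entry. -/
def LexBefore (f g : PairSimplex) : Prop :=
  ∃ i j : ℤ, 1 ≤ i ∧ i ≤ j ∧ g.mass s(i, j) < f.mass s(i, j) ∧
    ∀ k l : ℤ, 1 ≤ k → k ≤ l → (l < j ∨ (l = j ∧ k < i)) → f.mass s(k, l) = g.mass s(k, l)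

end PairSimplex

/-- The space `F↓` of rank-reordered elements of the simplex: the labels `1, 2, …` are in order of
nonincreasing total mass, and ties are broken lexicographically, so that among all the ranked
reorderings of an element the one that comes first in the lexicographic ordering is selected. -/
def RankedSimplex : Set PairSimplex :=
  {f | f.IsRanked ∧ ∀ g : PairSimplex, f.IsReordering g → g.IsRanked → ¬ g.LexBefore f}

/-! ### The network generated by an element of the simplex -/

/-- Every set of pairs of labels is measurable. -/
instance : DiscreteMeasurableSpace (Sym2 ℤ) where
  forall_measurableSet s :=
    show MeasurableSet (Quot.mk (Sym2.Rel ℤ) ⁻¹' s) from MeasurableSet.of_discrete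

/-- The distribution on pairs of labels that gives `{i, j}` the probability `f_{i,j}`. -/
noncomputable def pairLaw (f : PairSimplex) : Measure (Sym2 ℤ) :=
  Measure.sum fun s => ENNReal.ofReal (f.mass s) • Measure.dirac s

instance (f : PairSimplex) : IsProbabilityMeasure (pairLaw f) := ⟨by
  rw [pairLaw, Measure.sum_apply _ MeasurableSet.univ]
  simp only [Measure.smul_apply, measure_univ, smul_eq_mul, mul_one]
  rw [← ENNReal.ofReal_tsum_of_nonneg f.nonneg f.hasSum_one.summable, f.hasSum_one.tsum_eq,
    ENNReal.ofReal_one]⟩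

/-- The new value of the counter `m` when the pair `x` is drawn: it decreases by the number of
new vertices that occur only in the present edge. -/
def nextCounter (z : ℤ) (x : Sym2 ℤ) : ℤ :=
  if 0 ∉ x then z else if x = s(-1, 0) then z - 2 else z - 1

/-- The vertices of the present edge when the pair `x` is drawn and the counter is `z ≤ 0`: a pair
without `0` is kept, `{0, j}` becomes `{z - 1, j}`, `{0, 0}` becomes the loop `{z - 1, z - 1}`, and
`{-1, 0}` becomes `{z - 1, z - 2}`. -/
def blipEdge (z : ℤ) (x : Sym2 ℤ) : Sym2 ℤ :=
  if 0 ∉ x then x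
  else if x = s(-1, 0) then s(z - 1, z - 2)
  else x.map fun j => if j = 0 then z - 1 else j

/-- The value of the counter before the edge labeled `n` is placed. -/
def counter (X : ℕ → Sym2 ℤ) : ℕ → ℤ
  | 0 => 0
  | n + 1 => nextCounter (counter X n) (X n)

/-- The selection function determined by a sequence of pairs of labels. -/
def selection (X : ℕ → Sym2 ℤ) : Interactions ℕ := fun n => blipEdge (counter X n) (X n)

/-- The distribution `ε_f` of the network induced by the selection function of an i.i.d. sequence
of pairs with distribution `f`. -/
noncomputable def networkLaw (f : PairSimplex) : Measure (Network ℕ) :=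
  (Measure.infinitePi fun _ : ℕ => pairLaw f).map fun X => inducedNetwork (selection X)

theorem measurable_counter (n : ℕ) : Measurable fun X : ℕ → Sym2 ℤ => counter X n := by
  induction n with
  | zero => exact measurable_const
  | succ n ih =>
    exact (measurable_from_prod_countable_right
      (f := fun p : ℤ × Sym2 ℤ => nextCounter p.1 p.2) fun _ => measurable_of_countable _).comp
      (ih.prodMk (measurable_pi_apply n))

theorem measurable_selection : Measurable selection :=
  measurable_pi_lambda _ fun n =>
    (measurable_from_prod_countable_right
      (f := fun p : ℤ × Sym2 ℤ => blipEdge p.1 p.2) fun _ => measurable_of_countable _).comp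
      ((measurable_counter n).prodMk (measurable_pi_apply n))

theorem measurable_inducedNetwork : Measurable (inducedNetwork : Interactions ℕ → Network ℕ) := by
  have h : ∀ n, Measurable[_, ⊤] fun I : Interactions ℕ => (inducedNetwork I).restrict n := by
    intro n
    have h1 : Measurable[_, ⊤] (inducedNetwork : Interactions (Fin n) → Network (Fin n)) :=
      @measurable_of_countable _ _ _ ⊤ _ _ _
    have h2 : Measurable fun (I : Interactions ℕ) (k : Fin n) => I k :=
      measurable_pi_lambda _ fun k => measurable_pi_apply _
    exact h1.comp h2
  rw [show (instMeasurableSpaceNetworkNat : MeasurableSpace (Network ℕ)) = _ from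
    network_measurableSpace_eq]
  refine Measurable.of_le_map (iSup_le fun n => ?_)
  exact MeasurableSpace.comap_le_iff_le_map.2 (h n).le_map

instance (f : PairSimplex) : IsProbabilityMeasure (networkLaw f) :=
  Measure.isProbabilityMeasure_map
    (measurable_inducedNetwork.comp measurable_selection).aemeasurable

end EdgeExch

/-!
A ranked element `f` is encoded by the probabilities of all finite networks under `networkLaw f`.
The encoding is injective: the empirical frequencies of pairs of vertices in the generated network
recover `f` up to a reordering, and the tie-breaking rule picks one reordering. Its range is
compact: a label above `m` has frequency at most `2 / (m + 1)`, so treating these labels as blips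
changes the probability of a finite network by an amount that tends to `0` uniformly in `f`.

For existence, sample edges with replacement from the first `N` edges of `Y`. Given `Y`, the
sampled network has law `networkLaw f` for a ranked `f`, and by exchangeability its first `n` edges
are distributed like those of `Y` up to the probability of a repeated sample, which tends to `0`.
A limit point of the distributions of the random encodings represents the law of `Y`.

For uniqueness, the probabilities of cylinder sets, as functions of the encoding, are continuous,
separate points and are closed under multiplication, because disjoint groups of edges are
independent under `networkLaw f`. By the Stone–Weierstrass theorem, a mixing measure is determined
by its integrals against them.
-/

namespace EdgeExch

/-! ### Networks and their finite restrictions -/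

theorem inducedNetwork_eq_iff {S : Type} {I J : Interactions S} :
    inducedNetwork I = inducedNetwork J ↔ SameNetwork I J := Quotient.eq

theorem Network.pullback_pullback {S T U : Type} (g : T → S) (h : U → T) (E : Network S) :
    (E.pullback g).pullback h = E.pullback (g ∘ h) := by
  induction E using Quotient.inductionOn
  rfl

theorem Network.pullback_restrict {T : Type} {n : ℕ} (g : T → Fin n) (E : Network ℕ) :
    (E.restrict n).pullback g = E.pullback fun t => (g t : ℕ) :=
  E.pullback_pullback _ _

theorem sameNetwork_of_tendsto {I J : Interactions ℕ} {ρ : ℕ → ℤ → ℤ} {τ : ℤ → ℤ}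
    (U : Filter ℕ) [U.NeBot]
    (hinj : ∀ k l, ∀ᶠ n in U, InjOn (ρ n) {v | v ∈ I k ∨ v ∈ I l})
    (hmap : ∀ k, ∀ᶠ n in U, J k = (I k).map (ρ n))
    (hlim : ∀ v ∈ I.vertices, ∀ᶠ n in U, ρ n v = τ v) : SameNetwork I J := by
  refine ⟨τ, fun a ha b hb hab => ?_, fun k => ?_⟩
  · obtain ⟨⟨k, hk⟩, l, hl⟩ := And.intro ha hb
    obtain ⟨n, hn, han, hbn⟩ := ((hinj k l).and ((hlim a ha).and (hlim b hb))).exists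
    exact hn (Or.inl hk) (Or.inr hl) (by rw [han, hbn, hab])
  · have hlim_k : ∀ᶠ n in U, ∀ v ∈ I k, ρ n v = τ v := by
      have hmem : ∀ v ∈ I k, v ∈ I.vertices := fun v hv => ⟨k, hv⟩
      induction hI : I k with | _ a b
      rw [hI] at hmem
      filter_upwards [hlim a (hmem a (by simp)), hlim b (hmem b (by simp))] with n ha hb v hv
      rcases Sym2.mem_iff.1 hv with rfl | rfl <;> assumption
    obtain ⟨n, hJ, hn⟩ := ((hmap k).and hlim_k).exists
    rw [hJ, Sym2.map_congr hn]

theorem Network.ext_restrict {E F : Network ℕ} (h : ∀ n, E.restrict n = F.restrict n) :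
    E = F := by
  obtain ⟨I, rfl⟩ := Quotient.exists_rep E
  obtain ⟨J, rfl⟩ := Quotient.exists_rep F
  choose ρ hinj hρ using fun n => inducedNetwork_eq_iff.1 (h n)
  have hmap : ∀ k n, k < n → J k = (I k).map (ρ n) := fun k n hk => hρ n ⟨k, hk⟩
  let U : Ultrafilter ℕ := Filter.hyperfilter ℕ
  have hU : ∀ k, ∀ᶠ n in (U : Filter ℕ), k < n := fun k =>
    Nat.hyperfilter_le_atTop (Filter.eventually_gt_atTop k)
  have hlim : ∀ v ∈ I.vertices, ∃ w, ∀ᶠ n in (U : Filter ℕ), ρ n v = w := by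
    rintro v ⟨k, hv⟩
    have hmem : ∀ᶠ n in (U : Filter ℕ), ρ n v ∈ J k := (hU k).mono fun n hn => by
      rw [hmap k n hn]
      exact Sym2.mem_map.2 ⟨v, hv, rfl⟩
    induction hJ : J k with | _ a b
    simp only [hJ, Sym2.mem_iff] at hmem
    exact (Ultrafilter.eventually_or.1 hmem).elim (⟨a, ·⟩) (⟨b, ·⟩)
  choose! τ hτ using hlim
  refine inducedNetwork_eq_iff.2 (sameNetwork_of_tendsto U (fun k l => ?_)
    (fun k => (hU k).mono (hmap k)) hτ)
  filter_upwards [hU k, hU l] with n hk hl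
  refine (hinj n).mono ?_
  rintro v (hv | hv)
  exacts [⟨⟨k, hk⟩, hv⟩, ⟨⟨l, hl⟩, hv⟩]

instance (n : ℕ) : MeasurableSpace (Network (Fin n)) := ⊤

theorem isEmbedding_restrict :
    Topology.IsEmbedding fun (E : Network ℕ) (n : ℕ) => E.restrict n :=
  ⟨⟨rfl⟩, fun _ _ h => Network.ext_restrict (congrFun h)⟩

instance : T2Space (Network ℕ) := isEmbedding_restrict.t2Space

instance : SecondCountableTopology (Network ℕ) := isEmbedding_restrict.secondCountableTopology

theorem measurable_restrict (n : ℕ) : Measurable (Network.restrict n) := by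
  refine measurable_iff_comap_le.2 (le_of_le_of_eq ?_ network_measurableSpace_eq.symm)
  exact le_iSup (fun n => MeasurableSpace.comap (Network.restrict n) ⊤) n

theorem measurable_network_iff {α : Type*} [MeasurableSpace α] {g : α → Network ℕ} :
    Measurable g ↔ ∀ n, Measurable fun a => (g a).restrict n := by
  refine ⟨fun h n => (measurable_restrict n).comp h, fun h => ?_⟩
  rw [measurable_iff_comap_le]
  refine (MeasurableSpace.comap_mono network_measurableSpace_eq.le).trans ?_
  rw [MeasurableSpace.comap_iSup]
  refine iSup_le fun n => ?_
  rw [MeasurableSpace.comap_comp]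
  exact (h n).comap_le

theorem measurableSet_pullback_mem {T : Type} [Finite T] (u : T → ℕ) (A : Set (Network T)) :
    MeasurableSet {E : Network ℕ | E.pullback u ∈ A} := by
  obtain ⟨N, hN⟩ := (finite_range u).bddAbove
  have hlt : ∀ t, u t < N + 1 := fun t => Nat.lt_succ_of_le (hN ⟨t, rfl⟩)
  have h : MeasurableSet {F : Network (Fin (N + 1)) | F.pullback (fun t => ⟨u t, hlt t⟩) ∈ A} :=
    trivial
  simpa only [preimage_ofPred_eq, Network.pullback_restrict] using measurable_restrict (N + 1) h

theorem measurable_pullback (g : ℕ → ℕ) : Measurable (Network.pullback g) := by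
  refine measurable_network_iff.2 fun n A _ => ?_
  simp only [Network.restrict, Network.pullback_pullback]
  exact measurableSet_pullback_mem _ A

/-- The networks whose restriction to the first `n` edges belongs to `A`. -/
def cylinderSet (n : ℕ) (A : Set (Network (Fin n))) : Set (Network ℕ) :=
  Network.restrict n ⁻¹' A

theorem measurableSet_cylinderSet (n : ℕ) (A : Set (Network (Fin n))) :
    MeasurableSet (cylinderSet n A) :=
  measurable_restrict n trivial

theorem isPiSystem_cylinderSet : IsPiSystem {B | ∃ n A, B = cylinderSet n A} := by
  rintro _ ⟨m, A, rfl⟩ _ ⟨n, B, rfl⟩ -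
  refine ⟨max m n, {E | E.pullback (Fin.castLE (le_max_left m n)) ∈ A ∧
    E.pullback (Fin.castLE (le_max_right m n)) ∈ B}, ?_⟩
  ext E
  simp only [cylinderSet, mem_inter_iff, mem_preimage, mem_ofPred_eq, Network.pullback_restrict]
  rfl

theorem generateFrom_cylinderSet :
    (inferInstance : MeasurableSpace (Network ℕ)) =
      MeasurableSpace.generateFrom {B | ∃ n A, B = cylinderSet n A} := by
  refine le_antisymm ?_ (MeasurableSpace.generateFrom_le ?_)
  · rw [network_measurableSpace_eq]
    refine iSup_le fun n => ?_
    rintro _ ⟨A, -, rfl⟩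
    exact MeasurableSpace.measurableSet_generateFrom ⟨n, A, rfl⟩
  · rintro _ ⟨n, A, rfl⟩
    exact measurableSet_cylinderSet n A

theorem network_measure_ext {μ ν : Measure (Network ℕ)} [IsProbabilityMeasure μ]
    [IsProbabilityMeasure ν] (h : ∀ n E, μ (cylinderSet n {E}) = ν (cylinderSet n {E})) :
    μ = ν := by
  refine ext_of_generate_finite _ generateFrom_cylinderSet isPiSystem_cylinderSet ?_ (by simp)
  rintro _ ⟨n, A, rfl⟩
  have hmap : μ.map (Network.restrict n) = ν.map (Network.restrict n) :=
    Measure.ext_of_singleton fun E => by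
      rw [Measure.map_apply (measurable_restrict n) (measurableSet_singleton E),
        Measure.map_apply (measurable_restrict n) (measurableSet_singleton E)]
      exact h n E
  rw [cylinderSet, ← Measure.map_apply (measurable_restrict n) trivial, hmap,
    Measure.map_apply (measurable_restrict n) trivial]

/-! ### Networks generated by pairs of labels -/

/-- The pairs of labels that can have positive mass in an element of the simplex. -/
@[ext]
structure ProperPair where
  /-- the two labels -/
  pair : Sym2 ℤ
  neg_one_le : ∀ i ∈ pair, -1 ≤ i
  eq_of_neg_one_mem : -1 ∈ pair → pair = s(-1, 0)

theorem ProperPair.pair_injective : Function.Injective pair := fun _ _ => ProperPair.ext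

instance : Countable ProperPair := ProperPair.pair_injective.countable

theorem ProperPair.exists_mk_iff {p q : ℤ} (hpq : p ≤ q) :
    (∃ s : ProperPair, s.pair = s(p, q)) ↔ -1 ≤ p ∧ 0 ≤ q ∧ (p = -1 → q = 0) := by
  refine ⟨?_, fun ⟨hp, hq, h⟩ => ⟨⟨s(p, q), fun i hi => ?_, fun h' => ?_⟩, rfl⟩⟩
  · rintro ⟨s, hs⟩
    have hp := s.neg_one_le p (by simp [hs])
    have hneg := s.eq_of_neg_one_mem
    simp only [hs, Sym2.mem_iff, Sym2.eq_iff] at hneg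
    omega
  · rcases Sym2.mem_iff.1 hi with rfl | rfl <;> omega
  · rw [Sym2.mem_iff] at h'
    rw [show p = -1 by omega, h (by omega)]

theorem ProperPair.exists_eq_mk (s : ProperPair) :
    ∃ p q, p ≤ q ∧ -1 ≤ p ∧ 0 ≤ q ∧ (p = -1 → q = 0) ∧ s.pair = s(p, q) := by
  have h : ∃ p q, p ≤ q ∧ s.pair = s(p, q) := by
    induction s.pair with | _ a b
    exact (le_total a b).elim (⟨a, b, ·, rfl⟩) (⟨b, a, ·, Sym2.eq_swap⟩)
  obtain ⟨p, q, hpq, hs⟩ := h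
  obtain ⟨hp, hq, h⟩ := (exists_mk_iff hpq).1 ⟨s, hs⟩
  exact ⟨p, q, hpq, hp, hq, h, hs⟩

/-- The label `j ≥ 1` stands for a vertex of the same name; the labels `0` and `-1` stand for
vertices of the present edge only, named after the value `z` of a counter. -/
def freshVertex (z j : ℤ) : ℤ := if 1 ≤ j then j else z + j - 1

/-- The counters `z` let the labels `0` and `-1` of different edges stand for different
vertices. -/
def IsFresh {S : Type} (z : S → ℤ) (X : S → ProperPair) : Prop :=
  (∀ k, z k ≤ 0) ∧
    ∀ k l, k ≠ l → ∀ i ∈ (X k).pair, ∀ j ∈ (X l).pair, i ≤ 0 → j ≤ 0 → z k + i ≠ z l + j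

theorem IsFresh.freshVertex_eq_iff {S : Type} {z : S → ℤ} {X : S → ProperPair}
    (hz : IsFresh z X) {k l : S} {i j : ℤ} (hi : i ∈ (X k).pair) (hj : j ∈ (X l).pair) :
    freshVertex (z k) i = freshVertex (z l) j ↔ i = j ∧ (1 ≤ i ∨ k = l) := by
  have hk := hz.1 k
  have hl := hz.1 l
  by_cases hkl : k = l
  · subst hkl
    simp only [freshVertex]
    grind
  · have h := hz.2 k l hkl i hi j hj
    simp only [freshVertex]
    grind

theorem sameNetwork_map_of_eq_iff {S : Type} {X : S → Sym2 ℤ} {φ ψ : S → ℤ → ℤ}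
    (h : ∀ k l, ∀ i ∈ X k, ∀ j ∈ X l, φ k i = φ l j ↔ ψ k i = ψ l j) :
    SameNetwork (fun k => (X k).map (φ k)) (fun k => (X k).map (ψ k)) := by
  let endpoint (φ : S → ℤ → ℤ) (p : {p : S × ℤ // p.2 ∈ X p.1}) : ℤ := φ p.1.1 p.1.2
  have hfac : (endpoint ψ).FactorsThrough (endpoint φ) := fun p q =>
    (h p.1.1 q.1.1 p.1.2 p.2 q.1.2 q.2).1
  have hext : ∀ k, ∀ i ∈ X k, Function.extend (endpoint φ) (endpoint ψ) 0 (φ k i) = ψ k i :=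
    fun k i hi => hfac.extend_apply 0 ⟨(k, i), hi⟩
  refine ⟨Function.extend (endpoint φ) (endpoint ψ) 0, ?_, fun k => ?_⟩
  · rintro _ ⟨k, hk⟩ _ ⟨l, hl⟩ heq
    obtain ⟨i, hi, rfl⟩ := Sym2.mem_map.1 hk
    obtain ⟨j, hj, rfl⟩ := Sym2.mem_map.1 hl
    rwa [hext k i hi, hext l j hj, ← h k l i hi j hj] at heq
  · rw [Sym2.map_map]
    exact (Sym2.map_congr (hext k)).symm

theorem IsFresh.sameNetwork {S : Type} {z w : S → ℤ} {X : S → ProperPair} (hz : IsFresh z X)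
    (hw : IsFresh w X) :
    SameNetwork (fun k => (X k).pair.map (freshVertex (z k)))
      (fun k => (X k).pair.map (freshVertex (w k))) :=
  sameNetwork_map_of_eq_iff fun _ _ _ hi _ hj => by
    rw [hz.freshVertex_eq_iff hi hj, hw.freshVertex_eq_iff hi hj]

theorem isFresh_of_injective {S : Type} {ι : S → ℕ} (hι : Function.Injective ι)
    (X : S → ProperPair) : IsFresh (fun k => -2 * (ι k : ℤ)) X := by
  refine ⟨fun k => by simp, fun k l hkl i hi j hj _ _ => ?_⟩
  have := (X k).neg_one_le i hi
  have := (X l).neg_one_le j hj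
  have := hι.ne hkl
  dsimp only
  omega

/-- The process in which each occurrence of the labels `0` and `-1` gets its own vertex. -/
def expand {S : Type} [Encodable S] (X : S → ProperPair) : Interactions S :=
  fun k => (X k).pair.map (freshVertex (-2 * (Encodable.encode k : ℤ)))

/-- The network generated by a family of pairs of labels. -/
def networkOf {S : Type} [Encodable S] (X : S → ProperPair) : Network S :=
  inducedNetwork (expand X)

theorem pullback_networkOf {S T : Type} [Encodable S] [Encodable T] {u : T → S}
    (hu : Function.Injective u) (X : S → ProperPair) :
    (networkOf X).pullback u = networkOf fun t => X (u t) :=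
  inducedNetwork_eq_iff.2 ((isFresh_of_injective (Encodable.encode_injective.comp hu) _).sameNetwork
    (isFresh_of_injective Encodable.encode_injective _))

theorem networkOf_eq_of_map {S : Type} [Encodable S] {X Y : S → ProperPair} {φ : S → ℤ → ℤ}
    (hY : ∀ k, (Y k).pair = (X k).pair.map (φ k))
    (h : ∀ k l, ∀ i ∈ (X k).pair, ∀ j ∈ (X l).pair,
      i = j ∧ (1 ≤ i ∨ k = l) ↔ φ k i = φ l j ∧ (1 ≤ φ k i ∨ k = l)) :
    networkOf X = networkOf Y := by
  have hX := isFresh_of_injective Encodable.encode_injective X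
  have hφ : ∀ k, ∀ i ∈ (X k).pair, φ k i ∈ (Y k).pair := fun k i hi => by
    rw [hY]
    exact Sym2.mem_map.2 ⟨i, hi, rfl⟩
  have hYfresh := isFresh_of_injective Encodable.encode_injective Y
  have hexpand : expand Y = fun k =>
      (X k).pair.map (freshVertex (-2 * (Encodable.encode k : ℤ)) ∘ φ k) := by
    funext k
    rw [expand, hY, Sym2.map_map]
  refine inducedNetwork_eq_iff.2 (hexpand ▸ ?_)
  refine sameNetwork_map_of_eq_iff fun k l i hi j hj => ?_
  rw [hX.freshVertex_eq_iff hi hj, h k l i hi j hj]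
  exact (hYfresh.freshVertex_eq_iff (hφ k i hi) (hφ l j hj)).symm

/-! ### The selection function -/

theorem nextCounter_le (z : ℤ) (x : Sym2 ℤ) : nextCounter z x ≤ z := by
  unfold nextCounter
  split_ifs <;> omega

theorem counter_antitone (X : ℕ → Sym2 ℤ) : Antitone (counter X) :=
  antitone_nat_of_succ_le fun _ => nextCounter_le _ _

theorem ProperPair.nextCounter_lt (x : ProperPair) (z : ℤ) {i : ℤ} (hi : i ∈ x.pair) (h0 : i ≤ 0) :
    nextCounter z x.pair < z + i := by
  have hle := x.neg_one_le i hi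
  have hneg := x.eq_of_neg_one_mem
  obtain rfl | rfl : i = 0 ∨ i = -1 := by omega
  · rw [nextCounter, if_neg (not_not.2 hi)]
    split_ifs <;> omega
  · simp only [nextCounter, hneg hi, Sym2.mem_iff, or_true, not_true_eq_false, if_false, if_true]
    omega

theorem isFresh_counter (X : ℕ → ProperPair) : IsFresh (counter fun k => (X k).pair) X := by
  have key : ∀ k l, k < l → ∀ i ∈ (X k).pair, i ≤ 0 →
      counter (fun k => (X k).pair) l < counter (fun k => (X k).pair) k + i :=
    fun k l hkl i hi h0 => (counter_antitone _ (Nat.succ_le_of_lt hkl)).trans_lt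
      ((X k).nextCounter_lt _ hi h0)
  refine ⟨fun k => counter_antitone _ k.zero_le, fun k l hkl i hi j hj hi0 hj0 => ?_⟩
  rcases lt_or_gt_of_ne hkl with h | h
  · linarith [key k l h i hi hi0]
  · linarith [key l k h j hj hj0]

theorem ProperPair.blipEdge_eq (x : ProperPair) (z : ℤ) :
    blipEdge z x.pair = x.pair.map (freshVertex z) := by
  obtain ⟨p, q, hpq, hp, hq, hneg, hx⟩ := x.exists_eq_mk
  rw [hx]
  simp only [blipEdge, Sym2.mem_iff, Sym2.eq_iff, Sym2.map_mk, freshVertex]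
  grind

theorem inducedNetwork_selection (X : ℕ → ProperPair) :
    inducedNetwork (selection fun k => (X k).pair) = networkOf X := by
  have hsel : (selection fun k => (X k).pair) =
      fun k => (X k).pair.map (freshVertex (counter (fun k => (X k).pair) k)) :=
    funext fun k => (X k).blipEdge_eq _
  exact inducedNetwork_eq_iff.2 (hsel ▸ (isFresh_counter X).sameNetwork
    (isFresh_of_injective Encodable.encode_injective X))

/-! ### The compact space of proper pairs -/

namespace ProperPair

theorem ext_labels {s t : ProperPair} (h : ∀ i, 1 ≤ i → (i ∈ s.pair ↔ i ∈ t.pair))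
    (hdiag : s.pair.IsDiag ↔ t.pair.IsDiag) : s = t := by
  obtain ⟨a, b, hab, ha, hb, hneg, hs⟩ := s.exists_eq_mk
  obtain ⟨c, d, hcd, hc, hd, hneg', ht⟩ := t.exists_eq_mk
  simp only [hs, ht, Sym2.mem_iff, Sym2.mk_isDiag_iff] at h hdiag
  have habcd : a = c ∧ b = d := by
    have := h a
    have := h b
    have := h c
    have := h d
    omega
  exact ProperPair.ext (by rw [hs, ht, habcd.1, habcd.2])

/-- A proper pair is determined by its labels `≥ 1` and by whether it is a loop. -/
def code (s : ProperPair) : (ℤ → Bool) × Bool :=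
  (fun i => decide (1 ≤ i ∧ i ∈ s.pair), decide s.pair.IsDiag)

theorem code_injective : Function.Injective code := fun s t h => by
  simp only [code, Prod.mk.injEq, funext_iff, decide_eq_decide] at h
  exact ext_labels (fun i hi => by simpa [hi] using h.1 i) h.2

theorem exists_code_eq {b : ℤ → Bool} {d : Bool} (h : ∀ i j k, b i → b j → b k →
    1 ≤ i ∧ (i = j ∨ j = k ∨ i = k) ∧ (d → i = j)) : ∃ s, code s = (b, d) := by
  suffices h : ∃ p q : ℤ, p ≤ q ∧ -1 ≤ p ∧ 0 ≤ q ∧ (p = -1 → q = 0) ∧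
      (∀ i, 1 ≤ i ∧ (i = p ∨ i = q) ↔ b i) ∧ (p = q ↔ d) by
    obtain ⟨p, q, hpq, hp, hq, hneg, hb, hd⟩ := h
    obtain ⟨s, hs⟩ := (exists_mk_iff hpq).2 ⟨hp, hq, hneg⟩
    exact ⟨s, by simp only [code, hs, Sym2.mem_iff, Sym2.mk_isDiag_iff, hb, hd,
      Bool.decide_eq_true]⟩
  by_cases hne : ∃ p q, p < q ∧ b p ∧ b q
  · obtain ⟨p, q, hpq, hp, hq⟩ := hne
    have h1 := h p q q hp hq hq
    refine ⟨p, q, hpq.le, by omega, by omega, by omega, fun i => ⟨?_, fun hi => ?_⟩, by grind⟩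
    · rintro ⟨-, rfl | rfl⟩ <;> assumption
    · have := h i p q hi hp hq
      omega
  · have huniq (i j : ℤ) (hi : b i) (hj : b j) : i = j := by
      by_contra hij
      rcases lt_or_gt_of_ne hij with h' | h'
      exacts [hne ⟨i, j, h', hi, hj⟩, hne ⟨j, i, h', hj, hi⟩]
    by_cases hne : ∃ q, b q
    · obtain ⟨q, hq⟩ := hne
      have h1 := (h q q q hq hq hq).1
      exact ⟨if d then q else 0, q, by grind⟩
    · exact ⟨if d then 0 else -1, 0, by grind⟩

theorem range_code : range code = {x | ∀ i j k, x.1 i → x.1 j → x.1 k →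
    1 ≤ i ∧ (i = j ∨ j = k ∨ i = k) ∧ (x.2 → i = j)} := by
  refine Subset.antisymm ?_ fun _ => exists_code_eq
  rintro _ ⟨s, rfl⟩ i j k
  obtain ⟨p, q, -, -, -, -, hs⟩ := s.exists_eq_mk
  simp only [code, hs, decide_eq_true_eq, Sym2.mem_iff, Sym2.mk_isDiag_iff]
  omega

/-- In this compact topology `{i, j}` tends to `{i, 0}`, `{j, j}` to `{0, 0}` and, for `i < j`,
`{i, j}` to `{-1, 0}` when the labels that change tend to infinity. -/
instance : TopologicalSpace ProperPair := .induced code inferInstance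

theorem isClosedEmbedding_code : Topology.IsClosedEmbedding code := by
  refine ⟨⟨⟨rfl⟩, code_injective⟩, range_code ▸ ?_⟩
  simp only [ofPred_forall]
  refine isClosed_iInter fun i => isClosed_iInter fun j => isClosed_iInter fun k => ?_
  have hc : Continuous fun x : (ℤ → Bool) × Bool => (x.1 i, x.1 j, x.1 k, x.2) := by fun_prop
  exact (isClosed_discrete {p : Bool × Bool × Bool × Bool | p.1 → p.2.1 → p.2.2.1 →
    1 ≤ i ∧ (i = j ∨ j = k ∨ i = k) ∧ (p.2.2.2 → i = j)}).preimage hc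

instance : CompactSpace ProperPair := isClosedEmbedding_code.compactSpace

instance : TopologicalSpace.MetrizableSpace ProperPair :=
  isClosedEmbedding_code.isEmbedding.metrizableSpace

instance : SecondCountableTopology ProperPair :=
  isClosedEmbedding_code.isEmbedding.secondCountableTopology

instance : MeasurableSpace ProperPair := ⊤

instance : DiscreteMeasurableSpace ProperPair := ⟨fun _ => trivial⟩

instance : BorelSpace ProperPair := ⟨borel_eq_top_of_countable.symm⟩

theorem isClopen_mem {i : ℤ} (hi : 1 ≤ i) : IsClopen {s : ProperPair | i ∈ s.pair} := by
  have hc : Continuous fun s : ProperPair => (code s).1 i :=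
    (continuous_apply i).comp (continuous_fst.comp isClosedEmbedding_code.continuous)
  convert (isClopen_discrete {true}).preimage hc using 1
  ext s
  simp [code, hi]

theorem isClopen_isDiag : IsClopen {s : ProperPair | s.pair.IsDiag} := by
  have hc : Continuous fun s : ProperPair => (code s).2 :=
    continuous_snd.comp isClosedEmbedding_code.continuous
  convert (isClopen_discrete {true}).preimage hc using 1
  ext s
  simp [code]

theorem isClopen_pair_eq {i j : ℤ} (hi : 1 ≤ i) (hj : 1 ≤ j) :
    IsClopen {s : ProperPair | s.pair = s(i, j)} := by
  have h : {s : ProperPair | s.pair = s(i, j)} = {s | i ∈ s.pair} ∩ {s | j ∈ s.pair} ∩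
      if i = j then {s | s.pair.IsDiag} else {s | s.pair.IsDiag}ᶜ := by
    ext ⟨s, -, -⟩
    induction s with | _ a b
    split_ifs <;> simp <;> omega
  rw [h]
  refine ((isClopen_mem hi).inter (isClopen_mem hj)).inter ?_
  split_ifs
  exacts [isClopen_isDiag, isClopen_isDiag.compl]

/-! ### Truncation of labels -/

theorem exists_trunc (m : ℤ) (s : ProperPair) : ∃ (t : ProperPair) (φ : ℤ → ℤ),
    t.pair = s.pair.map φ ∧ (∀ i ∈ s.pair, ∀ j ∈ s.pair, φ i = φ j → i = j) ∧
      ∀ i ∈ s.pair, if 1 ≤ i ∧ i ≤ m then φ i = i else φ i ≤ 0 := by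
  obtain ⟨p, q, hpq, hp, hq, hneg, hs⟩ := s.exists_eq_mk
  simp only [hs, Sym2.mem_iff, Sym2.map_mk]
  suffices h : ∃ p' q' : ℤ, (∃ t : ProperPair, t.pair = s(p', q')) ∧ (p' = q' ↔ p = q) ∧
      (if 1 ≤ p ∧ p ≤ m then p' = p else p' ≤ 0) ∧ if 1 ≤ q ∧ q ≤ m then q' = q else q' ≤ 0 by
    obtain ⟨p', q', ⟨t, ht⟩, hdiag, hp', hq'⟩ := h
    exact ⟨t, fun i => if i = p then p' else q', by grind⟩
  by_cases hqm : 1 ≤ q ∧ q ≤ m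
  · exact ⟨p, q, ⟨s, hs⟩, by grind⟩
  by_cases hpm : 1 ≤ p ∧ p ≤ m
  · refine ⟨p, 0, ?_, by grind⟩
    rw [Sym2.eq_swap]
    exact (exists_mk_iff (by omega)).2 (by omega)
  · exact ⟨if p = q then 0 else -1, 0, (exists_mk_iff (by grind)).2 (by grind), by grind⟩

/-- The pair in which the labels greater than `m` are replaced by the labels `0` and `-1` for
vertices that occur in no other edge. -/
noncomputable def trunc (m : ℤ) (s : ProperPair) : ProperPair := (s.exists_trunc m).choose

theorem mem_trunc_iff {m i : ℤ} {s : ProperPair} (hi : 1 ≤ i) :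
    i ∈ (trunc m s).pair ↔ i ≤ m ∧ i ∈ s.pair := by
  obtain ⟨φ, hφ, -, h⟩ := (s.exists_trunc m).choose_spec
  rw [trunc, hφ, Sym2.mem_map]
  grind

theorem isDiag_trunc {m : ℤ} {s : ProperPair} : (trunc m s).pair.IsDiag ↔ s.pair.IsDiag := by
  obtain ⟨φ, hφ, hinj, -⟩ := (s.exists_trunc m).choose_spec
  rw [trunc, hφ]
  induction hs : s.pair with | _ a b
  have := hinj a (by simp [hs]) b (by simp [hs])
  simp only [Sym2.map_mk, Sym2.mk_isDiag_iff]
  exact ⟨this, congrArg φ⟩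

theorem trunc_eq_trunc_iff {m : ℤ} {s t : ProperPair} : trunc m s = trunc m t ↔
    (∀ i ∈ Icc 1 m, i ∈ s.pair ↔ i ∈ t.pair) ∧ (s.pair.IsDiag ↔ t.pair.IsDiag) := by
  refine ⟨fun h => ⟨fun i hi => ?_, by rw [← isDiag_trunc (m := m), h, isDiag_trunc]⟩,
    fun h => ext_labels (fun i hi => ?_) ?_⟩
  · have := mem_trunc_iff (m := m) (s := s) hi.1
    rw [h, mem_trunc_iff hi.1] at this
    simpa [hi.2] using this.symm
  · rw [mem_trunc_iff hi, mem_trunc_iff hi]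
    exact and_congr_right fun hm => h.1 i ⟨hi, hm⟩
  · rw [isDiag_trunc, isDiag_trunc, h.2]

theorem isLocallyConstant_trunc (m : ℤ) : IsLocallyConstant (trunc m) := by
  let finiteCode (s : ProperPair) : (Finset.Icc 1 m → Bool) × Bool :=
    (fun i => decide ((i : ℤ) ∈ s.pair), decide s.pair.IsDiag)
  have hcont : Continuous finiteCode := by
    refine (continuous_pi fun i => ?_).prodMk ?_
    · exact (continuous_bool_rng true).2 (by
        simpa [preimage] using isClopen_mem (Finset.mem_Icc.1 i.2).1)
    · exact (continuous_bool_rng true).2 (by simpa [preimage] using isClopen_isDiag)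
  refine IsLocallyConstant.iff_exists_open _ |>.2 fun s => ?_
  refine ⟨finiteCode ⁻¹' {finiteCode s}, (isOpen_discrete _).preimage hcont, rfl, fun t ht => ?_⟩
  simp only [finiteCode, mem_preimage, mem_singleton_iff, Prod.mk.injEq, funext_iff,
    decide_eq_decide, Subtype.forall, Finset.mem_Icc] at ht
  exact trunc_eq_trunc_iff.2 ht

end ProperPair

theorem networkOf_trunc {S : Type} [Encodable S] {m : ℤ} {X : S → ProperPair}
    (h : ∀ k l, k ≠ l → ∀ i, m < i → i ∈ (X k).pair → i ∉ (X l).pair) :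
    networkOf (fun k => (X k).trunc m) = networkOf X := by
  choose φ hφ hinj hval using fun k => ((X k).exists_trunc m).choose_spec
  refine (networkOf_eq_of_map hφ fun k l i hi j hj => ?_).symm
  have hk := hval k i hi
  have hl := hval l j hj
  by_cases hkl : k = l
  · subst hkl
    have := hinj k i hi j hj
    grind
  · have := h k l hkl i
    grind

/-! ### Distributions of proper pairs -/

theorem pairLaw_singleton (f : PairSimplex) (s : Sym2 ℤ) :
    pairLaw f {s} = ENNReal.ofReal (f.mass s) := by
  rw [pairLaw, Measure.sum_apply _ (measurableSet_singleton s), tsum_eq_single s]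
  · simp
  · intro t ht
    simp [ht]

theorem pairLaw_real_singleton (f : PairSimplex) (s : Sym2 ℤ) :
    (pairLaw f).real {s} = f.mass s := by
  rw [measureReal_def, pairLaw_singleton, ENNReal.toReal_ofReal (f.nonneg s)]

theorem ae_mass_ne_zero (f : PairSimplex) : ∀ᵐ s ∂pairLaw f, f.mass s ≠ 0 := by
  refine (measure_null_iff_singleton (to_countable _)).2 fun s hs => ?_
  rw [pairLaw_singleton, not_not.1 hs, ENNReal.ofReal_zero]

theorem PairSimplex.exists_properPair (f : PairSimplex) {s : Sym2 ℤ} (hs : f.mass s ≠ 0) :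
    ∃ t : ProperPair, t.pair = s := by
  refine ⟨⟨s, fun i hi => not_lt.1 fun h => hs (f.label_ge s i hi h), fun hm => ?_⟩, rfl⟩
  obtain ⟨j, rfl⟩ := Sym2.mem_iff_exists.1 hm
  rw [not_ne_iff.1 (mt (f.neg_one j) hs)]

theorem ProperPair.measurableEmbedding_pair : MeasurableEmbedding pair where
  injective := pair_injective
  measurable := measurable_of_countable _
  measurableSet_image' _ _ := .of_discrete

theorem ae_mem_range_pair (f : PairSimplex) : ∀ᵐ s ∂pairLaw f, s ∈ range ProperPair.pair := by
  filter_upwards [ae_mass_ne_zero f] with s hs using f.exists_properPair hs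

/-- The distribution on proper pairs that gives `{i, j}` the probability `f_{i,j}`. -/
noncomputable def law (f : PairSimplex) : ProbabilityMeasure ProperPair :=
  ⟨(pairLaw f).comap ProperPair.pair,
    ProperPair.measurableEmbedding_pair.isProbabilityMeasure_comap (ae_mem_range_pair f)⟩

theorem map_pair_law (f : PairSimplex) :
    (law f : Measure ProperPair).map ProperPair.pair = pairLaw f :=
  (ProperPair.measurableEmbedding_pair.map_comap _).trans
    (Measure.restrict_eq_self_of_ae_mem (ae_mem_range_pair f))

theorem law_real_pair_eq (f : PairSimplex) (s : Sym2 ℤ) :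
    (law f : Measure ProperPair).real {t | t.pair = s} = f.mass s := by
  rw [← pairLaw_real_singleton, ← map_pair_law,
    map_measureReal_apply (measurable_of_countable _) (measurableSet_singleton s)]
  rfl

theorem law_singleton (f : PairSimplex) (s : ProperPair) :
    (law f : Measure ProperPair) {s} = ENNReal.ofReal (f.mass s.pair) := by
  rw [← law_real_pair_eq, ofReal_measureReal]
  simp [← ProperPair.ext_iff]

theorem ae_law_mass_ne_zero (f : PairSimplex) :
    ∀ᵐ s ∂(law f : Measure ProperPair), f.mass s.pair ≠ 0 := by
  have h := ae_mass_ne_zero f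
  rw [← map_pair_law] at h
  exact ae_of_ae_map (measurable_of_countable ProperPair.pair).aemeasurable h

theorem hasSum_measureReal_iUnion {α ι : Type*} [MeasurableSpace α] [Countable ι]
    {μ : Measure α} [IsFiniteMeasure μ] {s : ι → Set α} (hd : Pairwise (Function.onFun Disjoint s))
    (hs : ∀ i, MeasurableSet (s i)) : HasSum (fun i => μ.real (s i)) (μ.real (⋃ i, s i)) := by
  have h := measure_iUnion (μ := μ) hd hs
  rw [measureReal_def, h, ENNReal.tsum_toReal_eq fun i => measure_ne_top _ _]
  exact ENNReal.hasSum_toReal (h ▸ measure_ne_top _ _)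

/-- The element of the simplex that consists of the probabilities of the pairs under `μ`. -/
noncomputable def ofLaw (μ : ProbabilityMeasure ProperPair) : PairSimplex where
  mass s := (μ : Measure ProperPair).real {t | t.pair = s}
  nonneg _ := measureReal_nonneg
  label_ge s i hi h := by
    convert measureReal_empty
    refine eq_empty_of_forall_notMem fun t (ht : t.pair = s) => ?_
    exact absurd (t.neg_one_le i (by rwa [ht])) (not_le.2 h)
  neg_one i hi := by
    convert measureReal_empty
    refine eq_empty_of_forall_notMem fun t (ht : t.pair = s(-1, i)) => hi ?_
    have h := t.eq_of_neg_one_mem (by simp [ht])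
    exact Sym2.congr_right.1 (ht.symm.trans h)
  hasSum_one := by
    convert hasSum_measureReal_iUnion (μ := (μ : Measure ProperPair))
      (s := fun s => {t | t.pair = s}) (fun a b hab => ?_) fun _ => .of_discrete
    · rw [show ⋃ s, {t : ProperPair | t.pair = s} = univ by ext; simp, probReal_univ]
    · exact disjoint_left.2 fun t ha hb => hab (ha.symm.trans hb)

theorem law_ofLaw (μ : ProbabilityMeasure ProperPair) : law (ofLaw μ) = μ := by
  refine Subtype.ext (Measure.ext_of_singleton fun s => ?_)
  refine (law_singleton _ s).trans ?_
  simp only [ofLaw, ← ProperPair.ext_iff, ofPred_eq_eq_singleton]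
  exact ofReal_measureReal

theorem law_injective : Function.Injective law := fun f g h => by
  ext s
  rw [← law_real_pair_eq, h, law_real_pair_eq]

theorem ProperPair.exists_nat_eq_mk {s : ProperPair} {i : ℤ} (hi : 1 ≤ i) (his : i ∈ s.pair) :
    ∃ j : ℕ, s.pair = s(i, (j : ℤ)) := by
  obtain ⟨j, hj⟩ := Sym2.mem_iff_exists.1 his
  have hle := s.neg_one_le j (by simp [hj])
  have hneg := s.eq_of_neg_one_mem
  simp only [hj, Sym2.mem_iff, Sym2.eq_iff] at hneg
  exact ⟨j.toNat, by rw [hj, Int.toNat_of_nonneg (by omega)]⟩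

theorem PairSimplex.degree_eq (f : PairSimplex) {i : ℤ} (hi : 1 ≤ i) :
    f.degree i = (law f : Measure ProperPair).real {s | i ∈ s.pair} := by
  have hset : {s : ProperPair | i ∈ s.pair} = ⋃ j : ℕ, {s | s.pair = s(i, (j : ℤ))} := by
    ext s
    simp only [mem_ofPred_eq, mem_iUnion]
    refine ⟨ProperPair.exists_nat_eq_mk hi, ?_⟩
    rintro ⟨j, hj⟩
    simp [hj]
  have h := hasSum_measureReal_iUnion (μ := (law f : Measure ProperPair))
    (s := fun j : ℕ => {s : ProperPair | s.pair = s(i, (j : ℤ))}) (fun a b hab => ?_)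
    fun _ => .of_discrete
  · simp only [law_real_pair_eq, ← hset] at h
    exact h.tsum_eq
  · refine disjoint_left.2 fun s (ha : s.pair = _) (hb : s.pair = _) => hab ?_
    exact_mod_cast Sym2.congr_right.1 (ha.symm.trans hb)

theorem PairSimplex.mem_active_of_mass_ne_zero {f : PairSimplex} {s : Sym2 ℤ}
    (hs : f.mass s ≠ 0) {i : ℤ} (hi : i ∈ s) (h1 : 1 ≤ i) : i ∈ f.active := by
  refine ⟨h1, ((f.nonneg s).lt_of_ne hs.symm).trans_le ?_⟩
  rw [f.degree_eq h1, ← law_real_pair_eq]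
  exact measureReal_mono fun t (ht : t.pair = s) => by rwa [mem_ofPred_eq, ht]

theorem PairSimplex.label_of_mass_ne_zero {f : PairSimplex} {s : ProperPair}
    (hs : f.mass s.pair ≠ 0) {i : ℤ} (hi : i ∈ s.pair) : i = -1 ∨ i = 0 ∨ i ∈ f.active := by
  rcases lt_or_ge 0 i with h | h
  · exact .inr (.inr (mem_active_of_mass_ne_zero hs hi h))
  · have := s.neg_one_le i hi
    omega

/-! ### Laws of networks -/

theorem measurable_networkOf : Measurable (networkOf : (ℕ → ProperPair) → Network ℕ) :=
  measurable_inducedNetwork.comp <| measurable_pi_lambda _ fun k =>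
    (measurable_of_countable fun s : ProperPair => s.pair.map _).comp (measurable_pi_apply k)

theorem networkLaw_eq_map (f : PairSimplex) : networkLaw f =
    (Measure.infinitePi fun _ : ℕ => (law f : Measure ProperPair)).map networkOf := by
  have hpair : Measurable ProperPair.pair := measurable_of_countable _
  have hsel := measurable_inducedNetwork.comp measurable_selection
  rw [networkLaw, ← map_pair_law, ← Measure.infinitePi_map_pi _ fun _ => hpair]
  refine (Measure.map_map hsel (by fun_prop)).trans ?_
  exact congrArg (Measure.map · _) (funext inducedNetwork_selection)

theorem networkLaw_pullback (f : PairSimplex) {T : Type} [Fintype T] [Encodable T] {u : T → ℕ}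
    (hu : Function.Injective u) (A : Set (Network T)) :
    networkLaw f {E | E.pullback u ∈ A} =
      Measure.pi (fun _ : T => (law f : Measure ProperPair)) {y | networkOf y ∈ A} := by
  rw [networkLaw_eq_map, Measure.map_apply measurable_networkOf (measurableSet_pullback_mem u A),
    ← Measure.infinitePi_eq_pi, ← Measure.map_infinitePi_infinitePi_of_inj
      (P := fun _ : ℕ => (law f : Measure ProperPair)) hu,
    Measure.map_apply (by fun_prop) (to_countable _).measurableSet]
  simp only [preimage_ofPred_eq, pullback_networkOf hu]

theorem networkLaw_cylinderSet (f : PairSimplex) (n : ℕ) (A : Set (Network (Fin n))) :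
    networkLaw f (cylinderSet n A) =
      Measure.pi (fun _ : Fin n => (law f : Measure ProperPair)) {y | networkOf y ∈ A} :=
  networkLaw_pullback f Fin.val_injective A

theorem networkLaw_cylinderSet_mul (f : PairSimplex) (m n : ℕ) (A : Set (Network (Fin m)))
    (B : Set (Network (Fin n))) :
    networkLaw f (cylinderSet m A) * networkLaw f (cylinderSet n B) =
      networkLaw f (cylinderSet (m + n)
        {E | E.pullback (Fin.castAdd n) ∈ A ∧ E.pullback (Fin.natAdd m) ∈ B}) := by
  have hmp := measurePreserving_sumPiEquivProdPi
    fun _ : Fin m ⊕ Fin n => (law f : Measure ProperPair)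
  have hu : Function.Injective fun k : Fin m ⊕ Fin n => (finSumFinEquiv k : ℕ) :=
    Fin.val_injective.comp finSumFinEquiv.injective
  have hcyl : cylinderSet (m + n)
      {E | E.pullback (Fin.castAdd n) ∈ A ∧ E.pullback (Fin.natAdd m) ∈ B} =
      {E | E.pullback (fun k : Fin m ⊕ Fin n => (finSumFinEquiv k : ℕ)) ∈
        {F | F.pullback Sum.inl ∈ A ∧ F.pullback Sum.inr ∈ B}} := by
    simp only [cylinderSet, preimage_ofPred_eq, Network.pullback_restrict, mem_ofPred_eq,
      Network.pullback_pullback]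
    rfl
  rw [hcyl, networkLaw_pullback f hu, networkLaw_cylinderSet, networkLaw_cylinderSet,
    ← Measure.prod_prod, ← hmp.measure_preimage (to_countable _).measurableSet.nullMeasurableSet]
  simp only [mem_ofPred_eq, pullback_networkOf Sum.inl_injective,
    pullback_networkOf Sum.inr_injective]
  rfl

/-! ### Reorderings -/

theorem measure_le_of_singleton {α : Type*} [Countable α] [MeasurableSpace α]
    [MeasurableSingletonClass α] {μ ν : Measure α} (h : ∀ a, μ {a} ≤ ν {a}) : μ ≤ ν := by
  refine Measure.le_iff.2 fun s hs => ?_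
  rw [← Measure.tsum_indicator_apply_singleton μ s hs,
    ← Measure.tsum_indicator_apply_singleton ν s hs]
  exact ENNReal.tsum_le_tsum fun a => indicator_le_indicator (h a)

theorem injOn_sym2_map {α β : Type*} {ρ : α → β} {A : Set α} (hρ : InjOn ρ A) :
    InjOn (Sym2.map ρ) {s | ∀ i ∈ s, i ∈ A} := by
  intro s hs t ht h
  induction s with | _ a b
  induction t with | _ c d
  simp only [mem_ofPred_eq, Sym2.mem_iff, forall_eq_or_imp, forall_eq] at hs ht
  simpa only [Sym2.map_mk, Sym2.eq_iff, hρ.eq_iff hs.1 ht.1, hρ.eq_iff hs.2 ht.2,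
    hρ.eq_iff hs.1 ht.2, hρ.eq_iff hs.2 ht.1] using h

theorem injOn_of_bijOn_active {f g : PairSimplex} {ρ : ℤ → ℤ} (hneg : ρ (-1) = -1)
    (hzero : ρ 0 = 0) (hρ : BijOn ρ f.active g.active) :
    InjOn ρ {i | i = -1 ∨ i = 0 ∨ i ∈ f.active} := by
  have hpos : ∀ i ∈ f.active, 1 ≤ ρ i := fun i hi => (hρ.mapsTo hi).1
  rintro a (rfl | rfl | ha) b (rfl | rfl | hb) hab
  all_goals first | exact hρ.injOn ha hb hab | grind

theorem PairSimplex.IsReordering.exists_map_law {f g : PairSimplex} (h : f.IsReordering g) :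
    ∃ (ρ : ℤ → ℤ) (R : ProperPair → ProperPair), ρ (-1) = -1 ∧ ρ 0 = 0 ∧
      BijOn ρ f.active g.active ∧ (law f : Measure ProperPair).map R = law g ∧
      ∀ s : ProperPair, f.mass s.pair ≠ 0 → (R s).pair = s.pair.map ρ := by
  obtain ⟨ρ, hneg, hzero, hbij, hmass⟩ := h
  have hmass' : ∀ s : ProperPair, f.mass s.pair ≠ 0 → g.mass (s.pair.map ρ) = f.mass s.pair :=
    fun s hs => hmass _ fun i => label_of_mass_ne_zero hs
  have hR : ∀ s : ProperPair, ∃ t : ProperPair,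
      f.mass s.pair ≠ 0 → t.pair = s.pair.map ρ := fun s => by
    by_cases hs : f.mass s.pair = 0
    · exact ⟨s, fun h => absurd hs h⟩
    · obtain ⟨t, ht⟩ := g.exists_properPair (hmass' s hs ▸ hs)
      exact ⟨t, fun _ => ht⟩
  choose R hR using hR
  have hRm : Measurable R := measurable_of_countable _
  refine ⟨ρ, R, hneg, hzero, hbij, ?_, hR⟩
  have := Measure.isProbabilityMeasure_map (μ := (law f : Measure ProperPair)) hRm.aemeasurable
  refine Measure.eq_of_le_of_isProbabilityMeasure (measure_le_of_singleton fun t => ?_)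
  rw [Measure.map_apply hRm (measurableSet_singleton t)]
  by_cases ht : ∃ s : ProperPair, f.mass s.pair ≠ 0 ∧ R s = t
  · obtain ⟨s, hs, rfl⟩ := ht
    rw [law_singleton, hR s hs, hmass' s hs, ← law_singleton]
    refine measure_mono_ae ?_
    filter_upwards [ae_law_mass_ne_zero f] with a ha (hab : R a = R s)
    refine ProperPair.ext (injOn_sym2_map (injOn_of_bijOn_active hneg hzero hbij)
      (fun i => label_of_mass_ne_zero ha) (fun i => label_of_mass_ne_zero hs) ?_)
    rw [← hR a ha, ← hR s hs, hab]
  · refine le_of_eq_of_le (measure_eq_zero_iff_ae_notMem.2 ?_) zero_le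
    filter_upwards [ae_law_mass_ne_zero f] with a ha hab
    exact ht ⟨a, ha, hab⟩

theorem PairSimplex.IsReordering.networkLaw_eq {f g : PairSimplex} (h : f.IsReordering g) :
    networkLaw f = networkLaw g := by
  obtain ⟨ρ, R, hneg, hzero, hbij, hmap, hR⟩ := h.exists_map_law
  have hRm : Measurable R := measurable_of_countable _
  rw [networkLaw_eq_map, networkLaw_eq_map, ← hmap, ← Measure.infinitePi_map_pi _ fun _ => hRm,
    Measure.map_map measurable_networkOf (by fun_prop)]
  have hae : ∀ᵐ X ∂Measure.infinitePi fun _ : ℕ => (law f : Measure ProperPair),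
      ∀ k, f.mass (X k).pair ≠ 0 :=
    ae_all_iff.2 fun k => (measurePreserving_eval_infinitePi
      (fun _ : ℕ => (law f : Measure ProperPair)) k).quasiMeasurePreserving.ae
        (ae_law_mass_ne_zero f)
  refine Measure.map_congr ?_
  filter_upwards [hae] with X hX
  refine networkOf_eq_of_map (fun k => hR _ (hX k)) fun k l i hi j hj => ?_
  have hi' := label_of_mass_ne_zero (hX k) hi
  rw [(injOn_of_bijOn_active hneg hzero hbij).eq_iff hi' (label_of_mass_ne_zero (hX l) hj)]
  have hpos : ∀ i ∈ f.active, 1 ≤ i ∧ 1 ≤ ρ i := fun i hi => ⟨hi.1, (hbij.mapsTo hi).1⟩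
  grind

open Filter Topology

/-! ### Frequencies determine the element of the simplex up to reordering -/

/-- The set `B` of edge labels has asymptotic frequency `a`. -/
def HasFrequency (B : Set ℕ) (a : ℝ) : Prop :=
  Tendsto (fun n : ℕ => (∑ k ∈ Finset.range n, B.indicator (fun _ => (1 : ℝ)) k) / n) atTop (𝓝 a)

theorem HasFrequency.unique {B : Set ℕ} {a b : ℝ} (ha : HasFrequency B a)
    (hb : HasFrequency B b) : a = b := tendsto_nhds_unique ha hb

theorem hasFrequency_zero_of_finite {B : Set ℕ} (hB : B.Finite) : HasFrequency B 0 := by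
  refine squeeze_zero (fun n => ?_) (fun n => ?_)
    (tendsto_const_div_atTop_nhds_zero_nat (B.ncard : ℝ))
  · exact div_nonneg (Finset.sum_nonneg fun k _ => indicator_nonneg (fun _ _ => zero_le_one) k)
      n.cast_nonneg
  · refine div_le_div_of_nonneg_right ?_ n.cast_nonneg
    classical
    rw [← hB.coe_toFinset, ncard_coe_finset]
    simp only [indicator_apply, Finset.mem_coe, Finset.sum_boole, Nat.cast_le]
    exact Finset.card_le_card fun k hk => (Finset.mem_filter.1 hk).2

theorem HasFrequency.infinite {B : Set ℕ} {a : ℝ} (hB : HasFrequency B a) (ha : a ≠ 0) :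
    B.Infinite := fun h => ha (hB.unique (hasFrequency_zero_of_finite h))

theorem ae_hasFrequency {E : Type*} [MeasurableSpace E] (μ : Measure E) [IsProbabilityMeasure μ]
    {A : Set E} (hA : MeasurableSet A) :
    ∀ᵐ X ∂Measure.infinitePi fun _ : ℕ => μ, HasFrequency {k | X k ∈ A} (μ.real A) := by
  have hind : Measurable (A.indicator fun _ => (1 : ℝ)) := measurable_const.indicator hA
  have heval := fun k => measurePreserving_eval_infinitePi (fun _ : ℕ => μ) k
  have hmean : ∫ X, A.indicator (fun _ => (1 : ℝ)) (X 0) ∂Measure.infinitePi (fun _ : ℕ => μ) =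
      μ.real A := by
    have h := integral_map (heval 0).measurable.aemeasurable
      (hind.aestronglyMeasurable (μ := (Measure.infinitePi fun _ : ℕ => μ).map (Function.eval 0)))
    rw [(heval 0).map_eq] at h
    exact h.symm.trans (integral_indicator_one hA)
  have hident : ∀ i, (Measure.infinitePi fun _ : ℕ => μ).map
      (fun X => A.indicator (fun _ => (1 : ℝ)) (X i)) =
      μ.map (A.indicator fun _ => (1 : ℝ)) := fun i =>
    (Measure.map_map hind (heval i).measurable).symm.trans (by rw [(heval i).map_eq])
  have h := ProbabilityTheory.strong_law_ae_real (μ := Measure.infinitePi fun _ : ℕ => μ)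
    (fun k X => A.indicator (fun _ => (1 : ℝ)) (X k)) ?_ ?_ ?_
  · rwa [hmean] at h
  · exact (integrable_const 1).mono' (hind.comp (heval 0).measurable).aestronglyMeasurable
      (ae_of_all _ fun X => (norm_indicator_le_norm_self _ _).trans_eq norm_one)
  · exact fun i j hij => (ProbabilityTheory.iIndepFun_infinitePi (P := fun _ : ℕ => μ)
      (X := fun _ => A.indicator fun _ => (1 : ℝ)) fun _ => hind).indepFun hij
  · exact fun i => ⟨(hind.comp (heval i).measurable).aemeasurable,
      (hind.comp (heval 0).measurable).aemeasurable, (hident i).trans (hident 0).symm⟩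

/-- The sequences in which each pair has the frequency prescribed by `f`. -/
def typicalSequences (f : PairSimplex) : Set (ℕ → ProperPair) :=
  {X | (∀ k, f.mass (X k).pair ≠ 0) ∧ ∀ s : Sym2 ℤ, HasFrequency {k | (X k).pair = s} (f.mass s)}

theorem ae_mem_typicalSequences (f : PairSimplex) :
    ∀ᵐ X ∂Measure.infinitePi fun _ : ℕ => (law f : Measure ProperPair),
      X ∈ typicalSequences f := by
  have hmass : ∀ᵐ X ∂Measure.infinitePi fun _ : ℕ => (law f : Measure ProperPair),
      ∀ k, f.mass (X k).pair ≠ 0 := ae_all_iff.2 fun k => (measurePreserving_eval_infinitePi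
    (fun _ : ℕ => (law f : Measure ProperPair)) k).quasiMeasurePreserving.ae (ae_law_mass_ne_zero f)
  have hfreq := ae_all_iff.2 fun s : Sym2 ℤ =>
    ae_hasFrequency (law f : Measure ProperPair) (A := {t | t.pair = s}) .of_discrete
  filter_upwards [hmass, hfreq] with X hX hX'
  exact ⟨hX, fun s => law_real_pair_eq f s ▸ hX' s⟩

theorem mem_expand_iff {X : ℕ → ProperPair} {k : ℕ} {i : ℤ} (hi : 1 ≤ i) :
    i ∈ expand X k ↔ i ∈ (X k).pair := by
  refine Sym2.mem_map.trans ⟨?_, fun h => ⟨i, h, if_pos hi⟩⟩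
  rintro ⟨a, ha, rfl⟩
  simp only [freshVertex] at hi ⊢
  split_ifs at hi ⊢
  · exact ha
  · omega

theorem isDiag_expand_iff {X : ℕ → ProperPair} {k : ℕ} :
    (expand X k).IsDiag ↔ (X k).pair.IsDiag := by
  obtain ⟨a, b, -, -, -, -, hs⟩ := (X k).exists_eq_mk
  have h := (isFresh_of_injective Encodable.encode_injective X).freshVertex_eq_iff (k := k) (l := k)
    (i := a) (j := b) (by simp [hs]) (by simp [hs])
  rw [expand, hs, Sym2.map_mk, Sym2.mk_isDiag_iff, Sym2.mk_isDiag_iff, h]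
  tauto

theorem one_le_of_mem_expand {X : ℕ → ProperPair} {v : ℤ} {k l : ℕ} (hkl : k ≠ l)
    (hk : v ∈ expand X k) (hl : v ∈ expand X l) : 1 ≤ v := by
  obtain ⟨a, ha, rfl⟩ := Sym2.mem_map.1 hk
  obtain ⟨b, hb, hab⟩ := Sym2.mem_map.1 hl
  rw [eq_comm, (isFresh_of_injective Encodable.encode_injective X).freshVertex_eq_iff ha hb] at hab
  have ha1 := hab.2.resolve_right hkl
  rwa [freshVertex, if_pos ha1]

theorem exists_ne_mem_expand {f : PairSimplex} {X : ℕ → ProperPair} (hX : X ∈ typicalSequences f)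
    {v : ℤ} (hv : 1 ≤ v) {k : ℕ} (hk : v ∈ expand X k) : ∃ l, k ≠ l ∧ v ∈ expand X l := by
  obtain ⟨l, hl, hkl⟩ := ((hX.2 (X k).pair).infinite (hX.1 k)).exists_notMem_finset {k}
  refine ⟨l, fun h => hkl (by simp [h]), ?_⟩
  rw [mem_expand_iff hv] at hk ⊢
  rwa [show (X l).pair = (X k).pair from hl]

theorem mem_active_iff_of_typical {f : PairSimplex} {X : ℕ → ProperPair}
    (hX : X ∈ typicalSequences f) {i : ℤ} : i ∈ f.active ↔ 1 ≤ i ∧ ∃ k, i ∈ (X k).pair := by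
  refine ⟨fun hi => ⟨hi.1, ?_⟩, fun ⟨hi, k, hk⟩ => f.mem_active_of_mass_ne_zero (hX.1 k) hk hi⟩
  obtain ⟨j, hj⟩ : ∃ j : ℕ, f.mass s(i, (j : ℤ)) ≠ 0 := by
    by_contra! h
    exact hi.2.ne' (by simp only [PairSimplex.degree, h, tsum_zero])
  obtain ⟨k, hk⟩ := ((hX.2 s(i, (j : ℤ))).infinite hj).nonempty
  exact ⟨k, by simp [show (X k).pair = _ from hk]⟩

/-- The vertices `≥ 1` of the network generated by a typical sequence are those that occur in more
than one edge, so they are preserved by isomorphisms. -/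
theorem exists_map_of_networkOf_eq {f g : PairSimplex} {X Y : ℕ → ProperPair}
    (hX : X ∈ typicalSequences f) (hY : Y ∈ typicalSequences g) (h : networkOf X = networkOf Y) :
    ∃ ρ : ℤ → ℤ, InjOn ρ {i | ∃ k, i ∈ expand X k} ∧
      (∀ k, ∀ v ∈ expand X k, 1 ≤ ρ v ↔ 1 ≤ v) ∧ ∀ k, expand Y k = (expand X k).map ρ := by
  obtain ⟨ρ, hρ, hmap⟩ := inducedNetwork_eq_iff.1 h
  have hmem : ∀ k l, ∀ v ∈ expand X k, ρ v ∈ expand Y l ↔ v ∈ expand X l := by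
    intro k l v hv
    rw [hmap, Sym2.mem_map]
    refine ⟨fun ⟨w, hw, hwv⟩ => ?_, fun hv' => ⟨v, hv', rfl⟩⟩
    rwa [← hρ ⟨l, hw⟩ ⟨k, hv⟩ hwv]
  refine ⟨ρ, hρ, fun k v hv => ⟨fun h1 => ?_, fun h1 => ?_⟩, hmap⟩
  · obtain ⟨l, hkl, hl⟩ := exists_ne_mem_expand hY h1 ((hmem k k v hv).2 hv)
    exact one_le_of_mem_expand hkl hv ((hmem k l v hv).1 hl)
  · obtain ⟨l, hkl, hl⟩ := exists_ne_mem_expand hX h1 hv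
    exact one_le_of_mem_expand hkl ((hmem k k v hv).2 hv) ((hmem k l v hv).2 hl)

/-- The map `ρ` on the labels `≥ 1`, and the identity on the labels `0` and `-1`. -/
def extendLabels (ρ : ℤ → ℤ) (i : ℤ) : ℤ := if 1 ≤ i then ρ i else i

theorem ProperPair.exists_eq_map_extendLabels {ρ : ℤ → ℤ} {s : ProperPair}
    (hρ : ∀ i ∈ s.pair, 1 ≤ i → 1 ≤ ρ i) :
    ∃ t : ProperPair, t.pair = s.pair.map (extendLabels ρ) := by
  obtain ⟨a, b, hab, ha, hb, hneg, hs⟩ := s.exists_eq_mk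
  have hρa := hρ a (by simp [hs])
  have hρb := hρ b (by simp [hs])
  rw [hs, Sym2.map_mk]
  rcases le_total (extendLabels ρ a) (extendLabels ρ b) with h | h
  · refine (exists_mk_iff h).2 ?_
    simp only [extendLabels] at h ⊢
    grind
  · rw [Sym2.eq_swap]
    refine (exists_mk_iff h).2 ?_
    simp only [extendLabels] at h ⊢
    grind

theorem isDiag_map_iff {α β : Type*} {ρ : α → β} {s : Sym2 α} (hρ : InjOn ρ {i | i ∈ s}) :
    (s.map ρ).IsDiag ↔ s.IsDiag := by
  induction s with | _ a b
  exact hρ.eq_iff (Sym2.mem_mk_left a b) (Sym2.mem_mk_right a b)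

theorem pair_eq_map_of_expand_eq_map {X Y : ℕ → ProperPair} {ρ : ℤ → ℤ} {k : ℕ}
    (hρ : InjOn ρ {i | i ∈ expand X k}) (hpos : ∀ v ∈ expand X k, 1 ≤ ρ v ↔ 1 ≤ v)
    (hmap : expand Y k = (expand X k).map ρ) :
    (Y k).pair = (X k).pair.map (extendLabels ρ) := by
  have hmem : ∀ v, 1 ≤ v → (v ∈ expand X k ↔ v ∈ (X k).pair) := fun v => mem_expand_iff
  obtain ⟨t, ht⟩ := ProperPair.exists_eq_map_extendLabels (ρ := ρ) (s := X k)
    fun i hi h1 => (hpos i ((hmem i h1).2 hi)).2 h1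
  refine ht ▸ congrArg ProperPair.pair (ProperPair.ext_labels (fun i hi => ?_) ?_)
  · rw [← mem_expand_iff hi, hmap, ht, Sym2.mem_map, Sym2.mem_map]
    simp only [extendLabels]
    grind
  · rw [← isDiag_expand_iff, hmap, ht]
    rw [isDiag_map_iff hρ, isDiag_expand_iff, isDiag_map_iff fun i hi j hj hij => ?_]
    have hinj := fun hi1 hj1 => @hρ i ((hmem i hi1).2 hi) j ((hmem j hj1).2 hj)
    have hi1 := fun h => hpos i ((hmem i h).2 hi)
    have hj1 := fun h => hpos j ((hmem j h).2 hj)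
    simp only [extendLabels] at hij
    grind

theorem PairSimplex.isReordering_of_typical {f g : PairSimplex} {X Y : ℕ → ProperPair}
    (hX : X ∈ typicalSequences f) (hY : Y ∈ typicalSequences g) (h : networkOf X = networkOf Y) :
    f.IsReordering g := by
  obtain ⟨ρ, hρ, hpos, hmap⟩ := exists_map_of_networkOf_eq hX hY h
  have hpair : ∀ k, (Y k).pair = (X k).pair.map (extendLabels ρ) := fun k => by
    have hk : {i | i ∈ expand X k} ⊆ {i | ∃ k, i ∈ expand X k} := fun i hi => ⟨k, hi⟩
    exact pair_eq_map_of_expand_eq_map (hρ.mono hk) (hpos k) (hmap k)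
  have hvertex : ∀ i ∈ f.active, ∃ k, i ∈ expand X k := fun i hi => by
    obtain ⟨k, hk⟩ := ((mem_active_iff_of_typical hX).1 hi).2
    exact ⟨k, (mem_expand_iff hi.1).2 hk⟩
  have hext : EqOn ρ (extendLabels ρ) f.active := fun i hi => (if_pos hi.1).symm
  have hbij : BijOn (extendLabels ρ) f.active g.active := by
    refine BijOn.congr (f₁ := ρ) ⟨fun i hi => ?_, hρ.mono hvertex, fun j hj => ?_⟩ hext
    · obtain ⟨k, hk⟩ := hvertex i hi
      have hρi := (hpos k i hk).2 hi.1
      exact (mem_active_iff_of_typical hY).2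
        ⟨hρi, k, (mem_expand_iff hρi).1 (by rw [hmap, Sym2.mem_map]; exact ⟨i, hk, rfl⟩)⟩
    · obtain ⟨k, hk⟩ := ((mem_active_iff_of_typical hY).1 hj).2
      rw [← mem_expand_iff hj.1, hmap, Sym2.mem_map] at hk
      obtain ⟨i, hi, rfl⟩ := hk
      have hi1 := (hpos k i hi).1 hj.1
      exact ⟨i, (mem_active_iff_of_typical hX).2 ⟨hi1, k, (mem_expand_iff hi1).1 hi⟩, rfl⟩
  have hneg : extendLabels ρ (-1) = -1 := if_neg (by norm_num)
  have hzero : extendLabels ρ 0 = 0 := if_neg (by norm_num)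
  refine ⟨extendLabels ρ, hneg, hzero, hbij, fun s hs => ?_⟩
  refine (hY.2 _).unique (a := g.mass (s.map (extendLabels ρ))) ?_
  convert hX.2 s using 3 with k
  rw [hpair]
  exact (injOn_sym2_map (injOn_of_bijOn_active hneg hzero hbij)).eq_iff
    (fun i hi => label_of_mass_ne_zero (hX.1 k) hi) hs

theorem isReordering_of_networkLaw_eq {f g : PairSimplex} (h : networkLaw f = networkLaw g) :
    f.IsReordering g := by
  have hmeas : ∀ f : PairSimplex, ∃ A ⊆ typicalSequences f, MeasurableSet A ∧
      ∀ᵐ X ∂Measure.infinitePi fun _ : ℕ => (law f : Measure ProperPair), X ∈ A := by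
    intro f
    obtain ⟨A, hA, hm, h0⟩ := exists_measurable_superset_of_null (ae_mem_typicalSequences f)
    exact ⟨Aᶜ, compl_subset_comm.1 hA, hm.compl, by simpa [ae_iff] using h0⟩
  obtain ⟨A, hA, hAm, hA1⟩ := hmeas f
  obtain ⟨B, hB, hBm, hB1⟩ := hmeas g
  have hmeet : ¬ Disjoint (networkOf '' A) (networkOf '' B) := by
    intro hd
    obtain ⟨u, hAu, hBu, hu⟩ := (hAm.analyticSet_image measurable_networkOf).measurablySeparable
      (hBm.analyticSet_image measurable_networkOf) hd
    have hfu : ∀ᵐ E ∂networkLaw f, E ∈ u := by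
      rw [networkLaw_eq_map]
      refine (ae_map_iff measurable_networkOf.aemeasurable hu).2 ?_
      filter_upwards [hA1] with X hX using hAu ⟨X, hX, rfl⟩
    have hgu : ∀ᵐ E ∂networkLaw f, E ∉ u := by
      rw [h, networkLaw_eq_map]
      refine (ae_map_iff measurable_networkOf.aemeasurable hu.compl).2 ?_
      filter_upwards [hB1] with X hX using disjoint_left.1 hBu ⟨X, hX, rfl⟩
    obtain ⟨E, hE, hE'⟩ := (hfu.and hgu).exists
    exact hE' hE
  obtain ⟨_, ⟨X, hX, rfl⟩, Y, hY, hXY⟩ := not_disjoint_iff.1 hmeet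
  exact PairSimplex.isReordering_of_typical (hA hX) (hB hY) hXY.symm

/-! ### Uniqueness of the ranked element -/

theorem measure_eq_of_map_eq {α β : Type*} [MeasurableSpace α] [MeasurableSpace β]
    {μ : Measure α} {ν : Measure β} {R : α → β} (hR : Measurable R) (hmap : μ.map R = ν)
    {A : Set α} {B : Set β} (hB : MeasurableSet B) (h : ∀ᵐ a ∂μ, R a ∈ B ↔ a ∈ A) :
    μ A = ν B := by
  rw [← hmap, Measure.map_apply hR hB]
  exact measure_congr (h.mono fun a ha => propext ha.symm)

theorem PairSimplex.IsReordering.law_isDiag {f g : PairSimplex} (h : f.IsReordering g) :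
    (law f : Measure ProperPair) {s | s.pair.IsDiag} =
      (law g : Measure ProperPair) {s | s.pair.IsDiag} := by
  obtain ⟨ρ, R, hneg, hzero, hbij, hmap, hR⟩ := h.exists_map_law
  refine measure_eq_of_map_eq (measurable_of_countable R) hmap .of_discrete ?_
  filter_upwards [ae_law_mass_ne_zero f] with s hs
  simp only [hR s hs]
  exact isDiag_map_iff ((injOn_of_bijOn_active hneg hzero hbij).mono
    fun i => label_of_mass_ne_zero hs)

theorem PairSimplex.IsReordering.exists_degree_eq {f g : PairSimplex} (h : f.IsReordering g) :
    ∃ ρ : ℤ → ℤ, BijOn ρ f.active g.active ∧ ∀ i ∈ f.active, f.degree i = g.degree (ρ i) := by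
  obtain ⟨ρ, R, hneg, hzero, hbij, hmap, hR⟩ := h.exists_map_law
  refine ⟨ρ, hbij, fun i hi => ?_⟩
  rw [g.degree_eq (hbij.mapsTo hi).1, f.degree_eq hi.1, measureReal_def, measureReal_def]
  congr 1
  refine measure_eq_of_map_eq (measurable_of_countable R) hmap .of_discrete ?_
  filter_upwards [ae_law_mass_ne_zero f] with s hs
  simp only [hR s hs, Sym2.mem_map]
  refine ⟨fun ⟨j, hj, hji⟩ => ?_, fun his => ⟨i, his, rfl⟩⟩
  rwa [← injOn_of_bijOn_active hneg hzero hbij (label_of_mass_ne_zero hs hj) (.inr (.inr hi)) hji]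

theorem PairSimplex.degree_nonneg (f : PairSimplex) (i : ℤ) : 0 ≤ f.degree i :=
  tsum_nonneg fun _ => f.nonneg _

theorem PairSimplex.IsRanked.antitoneOn_degree {f : PairSimplex} (hf : f.IsRanked) :
    AntitoneOn f.degree (Ici 1) := by
  intro i hi j _ hij
  induction j, hij using Int.leInduction with
  | base => exact le_rfl
  | succ j hj ih => exact (hf j (hi.trans hj)).trans (ih (hi.trans hj))

theorem PairSimplex.IsRanked.degree_le_of_bijOn {f g : PairSimplex} (hf : f.IsRanked)
    (hg : g.IsRanked) {ρ : ℤ → ℤ} (hbij : BijOn ρ f.active g.active)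
    (hdeg : ∀ i ∈ f.active, f.degree i = g.degree (ρ i)) {i : ℤ} (hi : 1 ≤ i) :
    f.degree i ≤ g.degree i := by
  by_contra! hlt
  have hle : ∀ k ∈ Finset.Icc 1 i, f.degree i ≤ f.degree k := fun k hk =>
    hf.antitoneOn_degree (Finset.mem_Icc.1 hk).1 hi (Finset.mem_Icc.1 hk).2
  have hact : ∀ k ∈ Finset.Icc 1 i, k ∈ f.active := fun k hk =>
    ⟨(Finset.mem_Icc.1 hk).1, (g.degree_nonneg i).trans_lt (hlt.trans_le (hle k hk))⟩
  have hmaps : ∀ k ∈ Finset.Icc 1 i, ρ k ∈ Finset.Ico 1 i := by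
    intro k hk
    have hρk := (hbij.mapsTo (hact k hk)).1
    refine Finset.mem_Ico.2 ⟨hρk, not_le.1 fun hik => ?_⟩
    have := hg.antitoneOn_degree hi hρk hik
    linarith [hdeg k (hact k hk), hle k hk]
  obtain ⟨a, ha, b, hb, hab, h⟩ := Finset.exists_ne_map_eq_of_card_lt_of_maps_to
    (by rw [Int.card_Icc, Int.card_Ico]; omega) hmaps
  exact hab (hbij.injOn (hact a ha) (hact b hb) h)

theorem measure_singleton_eq_of_forall_ne {α : Type*} [Countable α] [MeasurableSpace α]
    [DiscreteMeasurableSpace α] {μ ν : Measure α} [IsFiniteMeasure μ] [IsFiniteMeasure ν]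
    {A : Set α} {x : α} (hx : x ∈ A) (hA : μ A = ν A) (h : ∀ y ∈ A, y ≠ x → μ {y} = ν {y}) :
    μ {x} = ν {x} := by
  have hdiff : μ (A \ {x}) = ν (A \ {x}) := by
    rw [← Measure.tsum_indicator_apply_singleton μ _ .of_discrete,
      ← Measure.tsum_indicator_apply_singleton ν _ .of_discrete]
    congr 2
    exact indicator_congr fun y hy => h y hy.1 hy.2
  have hμ := measure_inter_add_sdiff (μ := μ) A (measurableSet_singleton x)
  have hν := measure_inter_add_sdiff (μ := ν) A (measurableSet_singleton x)
  rw [inter_singleton_of_mem hx] at hμ hν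
  rw [← hA, ← hμ, hdiff] at hν
  exact ((ENNReal.add_left_inj (measure_ne_top _ _)).1 hν).symm

theorem ProperPair.measure_ext {μ ν : Measure ProperPair} [IsProbabilityMeasure μ]
    [IsProbabilityMeasure ν]
    (hpair : ∀ s : ProperPair, (∀ i ∈ s.pair, 1 ≤ i) → μ {s} = ν {s})
    (hdegree : ∀ i : ℤ, 1 ≤ i → μ {s | i ∈ s.pair} = ν {s | i ∈ s.pair})
    (hdiag : μ {s | s.pair.IsDiag} = ν {s | s.pair.IsDiag}) : μ = ν := by
  have hlabel : ∀ s : ProperPair, ∀ i ∈ s.pair, 1 ≤ i → μ {s} = ν {s} := by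
    intro s i hi hi1
    by_cases hs : ∀ j ∈ s.pair, 1 ≤ j
    · exact hpair s hs
    refine measure_singleton_eq_of_forall_ne (A := {s : ProperPair | i ∈ s.pair}) hi
      (hdegree i hi1) fun t (ht : i ∈ t.pair) hts => hpair t ?_
    obtain ⟨a, b, hab, ha, hb, hneg, hs'⟩ := s.exists_eq_mk
    obtain ⟨c, d, hcd, hc, hd, hneg', ht'⟩ := t.exists_eq_mk
    rw [ne_eq, ProperPair.ext_iff, hs', ht'] at hts
    simp only [hs', ht', Sym2.mem_iff, forall_eq_or_imp, forall_eq, Sym2.eq_iff] at hi hs ht hts ⊢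
    omega
  have hloop : ∀ s : ProperPair, s.pair.IsDiag → μ {s} = ν {s} := by
    intro s hs
    by_cases h : ∃ i ∈ s.pair, 1 ≤ i
    · exact hlabel s h.choose h.choose_spec.1 h.choose_spec.2
    refine measure_singleton_eq_of_forall_ne (A := {s : ProperPair | s.pair.IsDiag}) hs hdiag
      fun t (ht : t.pair.IsDiag) hts => ?_
    by_contra ht'
    exact hts (ext_labels (fun i hi => iff_of_false (fun hit => ht' (hlabel t i hit hi))
      fun his => h ⟨i, his, hi⟩) (iff_of_true ht hs))
  refine Measure.ext_of_singleton fun s => ?_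
  by_contra hs
  refine hs (measure_singleton_eq_of_forall_ne (mem_univ s) (by simp) fun t _ hts => ?_)
  by_contra ht
  exact hts (ext_labels (fun i hi => iff_of_false (fun hit => ht (hlabel t i hit hi))
    fun his => hs (hlabel s i his hi)) (iff_of_false (mt (hloop t) ht) (mt (hloop s) hs)))

/-- The masses of the pairs `{i, j}` with `i, j ≥ 1`, listed along the pairing function of `ℕ`;
restricted to `i ≤ j` this is the order `(1,1), (1,2), (2,2), (1,3), …`. -/
def PairSimplex.lexCoord (f : PairSimplex) (n : ℕ) : ℝ :=
  f.mass s((n.unpair.1 : ℤ) + 1, (n.unpair.2 : ℤ) + 1)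

theorem PairSimplex.lexCoord_pair (f : PairSimplex) (a b : ℕ) :
    f.lexCoord (Nat.pair a b) = f.mass s((a : ℤ) + 1, (b : ℤ) + 1) := by
  rw [lexCoord, Nat.unpair_pair]

theorem PairSimplex.lexCoord_pair_comm (f : PairSimplex) (a b : ℕ) :
    f.lexCoord (Nat.pair a b) = f.lexCoord (Nat.pair b a) := by
  rw [lexCoord_pair, lexCoord_pair, Sym2.eq_swap]

theorem pair_lt_pair_iff {a b c d : ℕ} (hab : a ≤ b) (hcd : c ≤ d) :
    Nat.pair a b < Nat.pair c d ↔ b < d ∨ b = d ∧ a < c := by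
  unfold Nat.pair
  rcases lt_trichotomy b d with h | rfl | h
  · simp only [h, true_or, iff_true]
    split_ifs <;> nlinarith
  · split_ifs <;> grind
  · simp only [h.not_gt, h.ne', false_and, or_self, iff_false, not_lt]
    split_ifs <;> nlinarith

theorem pair_lt_pair_swap {a b : ℕ} (hab : a < b) : Nat.pair a b < Nat.pair b a := by
  simp only [Nat.pair, hab, hab.not_gt, if_true, if_false]
  omega

theorem PairSimplex.lexBefore_iff {f g : PairSimplex} :
    f.LexBefore g ↔ toLex g.lexCoord < toLex f.lexCoord := by
  constructor
  · rintro ⟨i, j, hi, hij, hlt, heq⟩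
    lift i - 1 to ℕ using (by omega) with a ha
    lift j - 1 to ℕ using (by omega) with b hb
    obtain ⟨rfl, rfl⟩ : i = a + 1 ∧ j = b + 1 := by omega
    refine ⟨Nat.pair a b, fun n hn => ?_, by simpa [lexCoord_pair] using hlt⟩
    have hsorted : ∀ c d, c ≤ d → Nat.pair c d < Nat.pair a b →
        g.lexCoord (Nat.pair c d) = f.lexCoord (Nat.pair c d) := fun c d hcd h => by
      rw [pair_lt_pair_iff hcd (by omega)] at h
      rw [lexCoord_pair, lexCoord_pair]
      exact (heq _ _ (by omega) (by omega) (by omega)).symm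
    obtain ⟨⟨c, d⟩, rfl⟩ := Nat.pairEquiv.surjective n
    obtain hcd | hdc := le_or_gt c d
    · exact hsorted c d hcd hn
    · have := hsorted d c hdc.le ((pair_lt_pair_swap hdc).trans hn)
      rwa [g.lexCoord_pair_comm, f.lexCoord_pair_comm] at this
  · rintro ⟨n, heq, hlt⟩
    obtain ⟨⟨a, b⟩, rfl⟩ := Nat.pairEquiv.surjective n
    simp only [Nat.pairEquiv_apply, Function.uncurry, Pi.toLex_apply] at heq hlt
    have hab : a ≤ b := by
      by_contra! hba
      rw [f.lexCoord_pair_comm, g.lexCoord_pair_comm, heq _ (pair_lt_pair_swap hba)] at hlt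
      exact hlt.false
    rw [lexCoord_pair, lexCoord_pair] at hlt
    refine ⟨a + 1, b + 1, by omega, by omega, hlt, fun k l hk hkl h => ?_⟩
    lift k - 1 to ℕ using (by omega) with c hc
    lift l - 1 to ℕ using (by omega) with d hd
    obtain ⟨rfl, rfl⟩ : k = c + 1 ∧ l = d + 1 := by omega
    rw [← lexCoord_pair, ← lexCoord_pair,
      heq _ ((pair_lt_pair_iff (by omega) hab).2 (by omega))]

theorem eq_of_networkLaw_eq {f g : PairSimplex} (hf : f ∈ RankedSimplex) (hg : g ∈ RankedSimplex)
    (h : networkLaw f = networkLaw g) : f = g := by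
  have hfg := isReordering_of_networkLaw_eq h
  have hgf := isReordering_of_networkLaw_eq h.symm
  have hdegree : ∀ i : ℤ, 1 ≤ i → f.degree i = g.degree i := fun i hi =>
    have ⟨_, hρ, hdeg⟩ := hfg.exists_degree_eq
    have ⟨_, hρ', hdeg'⟩ := hgf.exists_degree_eq
    (hf.1.degree_le_of_bijOn hg.1 hρ hdeg hi).antisymm (hg.1.degree_le_of_bijOn hf.1 hρ' hdeg' hi)
  have hcoord : f.lexCoord = g.lexCoord := toLex.injective <| le_antisymm
    (not_lt.1 (mt PairSimplex.lexBefore_iff.2 (hg.2 f hgf hf.1)))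
    (not_lt.1 (mt PairSimplex.lexBefore_iff.2 (hf.2 g hfg hg.1)))
  have hpair : ∀ i j : ℤ, 1 ≤ i → 1 ≤ j → f.mass s(i, j) = g.mass s(i, j) := by
    intro i j hi hj
    lift i - 1 to ℕ using (by omega) with a ha
    lift j - 1 to ℕ using (by omega) with b hb
    rw [← sub_add_cancel i 1, ← sub_add_cancel j 1, ← ha, ← hb, ← f.lexCoord_pair, hcoord,
      g.lexCoord_pair]
  suffices hlaw : (law f : Measure ProperPair) = law g from law_injective (Subtype.ext hlaw)
  refine ProperPair.measure_ext (fun s hs => ?_) (fun i hi => ?_) hfg.law_isDiag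
  · obtain ⟨i, j, -, -, -, -, hij⟩ := s.exists_eq_mk
    rw [law_singleton, law_singleton, hij, hpair] <;> exact hs _ (by simp [hij])
  · rw [← measureReal_eq_measureReal_iff, ← f.degree_eq hi, ← g.degree_eq hi, hdegree i hi]

/-! ### Lexicographic maximization -/

theorem exists_isMaxOn_toLex {K : Set (ℕ → ℝ)} (hK : IsCompact K) (hne : K.Nonempty) :
    ∃ x ∈ K, IsMaxOn toLex K x := by
  let T : ℕ → Set (ℕ → ℝ) := fun n =>
    Nat.rec K (fun n S => S ∩ {x | ∀ y ∈ S, y n ≤ x n}) n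
  have hprop : ∀ n, IsCompact (T n) ∧ (T n).Nonempty := by
    intro n
    induction n with
    | zero => exact ⟨hK, hne⟩
    | succ n ih =>
      obtain ⟨x, hx, hmax⟩ := ih.1.exists_isMaxOn ih.2 (continuous_apply n).continuousOn
      refine ⟨ih.1.inter_right ?_, x, hx, hmax⟩
      simp only [ofPred_forall]
      exact isClosed_iInter fun y => isClosed_iInter fun _ =>
        isClosed_le continuous_const (continuous_apply n)
  obtain ⟨x, hx⟩ := IsCompact.nonempty_iInter_of_sequence_nonempty_isCompact_isClosed T
    (fun n => inter_subset_left) (fun n => (hprop n).2) hK fun n => (hprop n).1.isClosed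
  rw [mem_iInter] at hx
  refine ⟨x, hx 0, isMaxOn_iff.2 fun y hy => not_lt.1 ?_⟩
  rintro ⟨n, heq, hlt⟩
  have hmem : ∀ m ≤ n, y ∈ T m := by
    intro m hm
    induction m with
    | zero => exact hy
    | succ m ih =>
      refine ⟨ih (by omega), fun z hz => ?_⟩
      exact ((hx (m + 1)).2 z hz).trans_eq (heq m (by omega))
  exact hlt.not_ge ((hx (n + 1)).2 y (hmem n le_rfl))

/-! ### Finite networks and ranked distributions -/

theorem continuous_measureReal_of_isClopen {α : Type*} [TopologicalSpace α] [MeasurableSpace α]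
    [OpensMeasurableSpace α] [HasOuterApproxClosed α] {A : Set α} (hA : IsClopen A) :
    Continuous fun μ : ProbabilityMeasure α => (μ : Measure α).real A :=
  continuous_iff_continuousAt.2 fun _ => NNReal.tendsto_coe.2
    (ProbabilityMeasure.tendsto_measure_of_isClopen_of_tendsto tendsto_id hA)

/-- The distributions of proper pairs under which the labels `1, 2, …` have nonincreasing
frequencies. -/
def rankedLaws : Set (ProbabilityMeasure ProperPair) :=
  {μ | ∀ i : ℤ, 1 ≤ i → (μ : Measure ProperPair).real {s | i + 1 ∈ s.pair} ≤
    (μ : Measure ProperPair).real {s | i ∈ s.pair}}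

theorem law_mem_rankedLaws_iff {f : PairSimplex} : law f ∈ rankedLaws ↔ f.IsRanked :=
  forall₂_congr fun i hi => by rw [← f.degree_eq hi, ← f.degree_eq (by omega)]

theorem isCompact_rankedLaws : IsCompact rankedLaws := by
  refine IsClosed.isCompact ?_
  simp only [rankedLaws, ofPred_forall]
  refine isClosed_iInter fun i => isClosed_iInter fun hi => isClosed_le ?_ ?_ <;>
  exact continuous_measureReal_of_isClopen (ProperPair.isClopen_mem (by omega))

theorem card_filter_mem_sym2_le {ι α : Type*} [DecidableEq α] {e : ι → α}
    (he : Function.Injective e) (t : Finset ι) (s : Sym2 α) : (t.filter (e · ∈ s)).card ≤ 2 := by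
  induction s with | _ a b
  refine (Finset.card_le_card_of_injOn e (t := {a, b}) (fun i hi => ?_) he.injOn).trans
    Finset.card_le_two
  simpa using (Finset.mem_filter.1 hi).2

theorem sum_measureReal_mem_le (μ : ProbabilityMeasure ProperPair) (n : ℕ) :
    ∑ k ∈ Finset.range n, (μ : Measure ProperPair).real {s | (k : ℤ) + 1 ∈ s.pair} ≤ 2 := by
  classical
  have hint : ∀ k ∈ Finset.range n, Integrable
      ({s : ProperPair | (k : ℤ) + 1 ∈ s.pair}.indicator (1 : ProperPair → ℝ)) μ := fun k _ =>
    (integrable_const 1).indicator .of_discrete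
  simp only [← integral_indicator_one (MeasurableSet.of_discrete (α := ProperPair)),
    ← integral_finsetSum _ hint]
  refine (integral_mono (integrable_finsetSum _ hint) (integrable_const 2) fun s => ?_).trans_eq
    (by simp)
  have hcard := card_filter_mem_sym2_le (e := fun k : ℕ => (k : ℤ) + 1)
    (fun a b h => by simpa using h) (Finset.range n) s.pair
  simp only [indicator_apply, mem_ofPred_eq, Pi.one_apply, Finset.sum_boole]
  exact_mod_cast hcard

theorem measureReal_mem_le {μ : ProbabilityMeasure ProperPair} (hμ : μ ∈ rankedLaws) {m : ℕ} {i : ℤ}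
    (hi : m < i) : (μ : Measure ProperPair).real {s | i ∈ s.pair} ≤ 2 / (m + 1) := by
  have hanti : Antitone fun k : ℕ =>
      (μ : Measure ProperPair).real {s | (k : ℤ) + 1 ∈ s.pair} :=
    antitone_nat_of_succ_le fun k => by exact_mod_cast hμ (k + 1) (by omega)
  obtain ⟨j, rfl⟩ : ∃ j : ℕ, i = j + 1 := ⟨(i - 1).toNat, by omega⟩
  rw [le_div_iff₀' (by positivity)]
  calc ((m : ℝ) + 1) * (μ : Measure ProperPair).real {s | (j : ℤ) + 1 ∈ s.pair}
      = ∑ _k ∈ Finset.range (m + 1), (μ : Measure ProperPair).real {s | (j : ℤ) + 1 ∈ s.pair} := by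
        simp
    _ ≤ ∑ k ∈ Finset.range (m + 1), (μ : Measure ProperPair).real {s | (k : ℤ) + 1 ∈ s.pair} :=
        Finset.sum_le_sum fun k hk => hanti (by grind)
    _ ≤ 2 := sum_measureReal_mem_le μ _

theorem map_eval_pair_pi {ι α : Type*} [Fintype ι] [MeasurableSpace α] (μ : Measure α)
    [IsProbabilityMeasure μ] {k l : ι} (hkl : k ≠ l) :
    (Measure.pi fun _ : ι => μ).map (fun y => (y k, y l)) = μ.prod μ := by
  have hindep := (ProbabilityTheory.iIndepFun_pi (μ := fun _ : ι => μ) (X := fun _ => id)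
    fun _ => aemeasurable_id).indepFun hkl
  have hprod := (ProbabilityTheory.indepFun_iff_map_prod_eq_prod_map_map
    (measurable_pi_apply k).aemeasurable
    (measurable_pi_apply l).aemeasurable).1 hindep
  exact hprod.trans (congrArg₂ Measure.prod (measurePreserving_eval (fun _ : ι => μ) k).map_eq
    (measurePreserving_eval (fun _ : ι => μ) l).map_eq)

theorem pi_real_exists_ne_rel_le {ι α : Type*} [Fintype ι] [Countable α] [MeasurableSpace α]
    [DiscreteMeasurableSpace α] {μ : Measure α} [IsProbabilityMeasure μ] {R : α → α → Prop}
    {c : ℝ} (hR : ∀ a, μ.real {b | R a b} ≤ c) :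
    (Measure.pi fun _ : ι => μ).real {y | ∃ k l, k ≠ l ∧ R (y k) (y l)} ≤
      Fintype.card ι ^ 2 * c := by
  classical
  have hc : 0 ≤ c := measureReal_nonneg.trans (hR (nonempty_of_isProbabilityMeasure μ).some)
  have hpair : ∀ k l : ι, k ≠ l → (Measure.pi fun _ : ι => μ).real {y | R (y k) (y l)} ≤ c :=
    fun k l hkl => ENNReal.toReal_le_of_le_ofReal hc <| calc
      (Measure.pi fun _ : ι => μ) {y | R (y k) (y l)}
        = (μ.prod μ) {z | R z.1 z.2} := by
          rw [← map_eval_pair_pi _ hkl, Measure.map_apply (by fun_prop) .of_discrete]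
          rfl
      _ = ∫⁻ a, μ {b | R a b} ∂μ := Measure.prod_apply .of_discrete
      _ ≤ ∫⁻ _, ENNReal.ofReal c ∂μ := lintegral_mono fun a =>
          (ofReal_measureReal (μ := μ)).symm.trans_le (ENNReal.ofReal_le_ofReal (hR a))
      _ = ENNReal.ofReal c := by simp
  have hunion : {y : ι → α | ∃ k l, k ≠ l ∧ R (y k) (y l)} =
      ⋃ p ∈ Finset.univ.offDiag, {y | R (y p.1) (y p.2)} := by
    ext
    simp
  rw [hunion]
  refine (measureReal_biUnion_finset_le _ _).trans ((Finset.sum_le_card_nsmul _ _ c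
    fun p hp => hpair p.1 p.2 (Finset.mem_offDiag.1 hp).2.2).trans ?_)
  rw [nsmul_eq_mul]
  gcongr
  rw [Finset.offDiag_card, ← Finset.card_univ]
  norm_cast
  simp [sq]

theorem measureReal_exists_common_label_le {μ : ProbabilityMeasure ProperPair}
    (hμ : μ ∈ rankedLaws) (m : ℕ) (s : ProperPair) : (μ : Measure ProperPair).real
      {t | ∃ i : ℤ, m < i ∧ i ∈ s.pair ∧ i ∈ t.pair} ≤ 4 / (m + 1) := by
  obtain ⟨p, q, hpq⟩ : ∃ p q, s.pair = s(p, q) := s.pair.ind fun p q => ⟨p, q, rfl⟩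
  have hlabel : ∀ i : ℤ, (μ : Measure ProperPair).real {t | m < i ∧ i ∈ t.pair} ≤
      2 / (m + 1) := fun i => by
    by_cases hi : m < i
    · simpa only [hi, true_and] using measureReal_mem_le hμ hi
    · simp only [hi, false_and, ofPred_false, measureReal_empty]
      positivity
  calc (μ : Measure ProperPair).real {t | ∃ i : ℤ, m < i ∧ i ∈ s.pair ∧ i ∈ t.pair}
      ≤ (μ : Measure ProperPair).real
          ({t | m < p ∧ p ∈ t.pair} ∪ {t | m < q ∧ q ∈ t.pair}) := by
        refine measureReal_mono ?_
        rintro t ⟨i, hi, his, hit⟩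
        rcases Sym2.mem_iff.1 (hpq ▸ his) with rfl | rfl
        exacts [.inl ⟨hi, hit⟩, .inr ⟨hi, hit⟩]
    _ ≤ 2 / (m + 1) + 2 / (m + 1) :=
        (measureReal_union_le _ _).trans (add_le_add (hlabel p) (hlabel q))
    _ = 4 / (m + 1) := by ring

theorem abs_measureReal_sub_le {α : Type*} [MeasurableSpace α] {μ : Measure α}
    [IsFiniteMeasure μ] {A B C : Set α} (h : symmDiff A B ⊆ C) :
    |μ.real A - μ.real B| ≤ μ.real C := by
  have hsub : ∀ {A B : Set α}, A \ B ⊆ C → μ.real A - μ.real B ≤ μ.real C := fun {A B} h =>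
    sub_le_iff_le_add'.2 <| (measureReal_mono (by rwa [← sdiff_subset_iff])).trans
      (measureReal_union_le B C)
  exact abs_sub_le_iff.2 ⟨hsub (subset_union_left.trans h), hsub (subset_union_right.trans h)⟩

/-- The probabilities of the finite networks formed by independent pairs with distribution `μ`. -/
noncomputable def finiteProbs (μ : ProbabilityMeasure ProperPair)
    (c : Σ n, Network (Fin n)) : ℝ :=
  (Measure.pi fun _ : Fin c.1 => (μ : Measure ProperPair)).real {y | networkOf y = c.2}

theorem networkLaw_real_cylinderSet (f : PairSimplex) (c : Σ n, Network (Fin n)) :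
    (networkLaw f).real (cylinderSet c.1 {c.2}) = finiteProbs (law f) c := by
  rw [measureReal_def, networkLaw_cylinderSet]
  rfl

theorem finiteProbs_law_eq_iff {f g : PairSimplex} :
    finiteProbs (law f) = finiteProbs (law g) ↔ networkLaw f = networkLaw g := by
  refine ⟨fun h => network_measure_ext fun n E => ?_, fun h => funext fun c => ?_⟩
  · have h := congrFun h ⟨n, E⟩
    rwa [← networkLaw_real_cylinderSet, ← networkLaw_real_cylinderSet,
      measureReal_eq_measureReal_iff] at h
  · rw [← networkLaw_real_cylinderSet, h, networkLaw_real_cylinderSet]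

/-- Variant of `finiteProbs` in which every label above `m` is treated as a blip. -/
noncomputable def truncProbs (m : ℕ) (μ : ProbabilityMeasure ProperPair)
    (c : Σ n, Network (Fin n)) : ℝ :=
  (Measure.pi fun _ : Fin c.1 => (μ : Measure ProperPair)).real
    {y | networkOf (fun k => (y k).trunc m) = c.2}

theorem isLocallyConstant_comp_pi {ι X Y : Type*} [Finite ι] [TopologicalSpace X] {f : X → Y}
    (hf : IsLocallyConstant f) : IsLocallyConstant fun (y : ι → X) k => f (y k) := by
  refine (IsLocallyConstant.iff_eventually_eq _).2 fun y => ?_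
  have hk : ∀ k, ∀ᶠ z in 𝓝 y, f (z k) = f (y k) := fun k =>
    (continuous_apply k).continuousAt.eventually (hf.eventually_eq (y k))
  exact (eventually_all.2 hk).mono fun z => funext

theorem continuous_truncProbs (m : ℕ) : Continuous (truncProbs m) := by
  refine continuous_pi fun c => ?_
  have hclopen : IsClopen {y : Fin c.1 → ProperPair | networkOf (fun k => (y k).trunc m) = c.2} :=
    IsLocallyConstant.isClopen_fiber
      ((isLocallyConstant_comp_pi (ProperPair.isLocallyConstant_trunc m)).comp networkOf) c.2
  exact (continuous_measureReal_of_isClopen hclopen).comp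
    (ProbabilityMeasure.continuous_pi.comp (continuous_pi fun _ => continuous_id))

theorem abs_finiteProbs_sub_truncProbs_le {μ : ProbabilityMeasure ProperPair} (hμ : μ ∈ rankedLaws)
    (m : ℕ) (c : Σ n, Network (Fin n)) :
    |finiteProbs μ c - truncProbs m μ c| ≤ c.1 ^ 2 * (4 / (m + 1)) := by
  let C : Set (Fin c.1 → ProperPair) :=
    {y | ∃ k l, k ≠ l ∧ ∃ i : ℤ, m < i ∧ i ∈ (y k).pair ∧ i ∈ (y l).pair}
  have hsame : ∀ y ∉ C, networkOf (fun k => (y k).trunc m) = networkOf y := fun y hy =>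
    networkOf_trunc fun k l hkl i hi hik hil => hy ⟨k, l, hkl, i, hi, hik, hil⟩
  refine (abs_measureReal_sub_le (C := C) fun y hy => ?_).trans ?_
  · by_contra hC
    simp [mem_symmDiff, hsame y hC] at hy
  · simpa only [Fintype.card_fin] using
      pi_real_exists_ne_rel_le (ι := Fin c.1) (measureReal_exists_common_label_le hμ m)

theorem continuousOn_finiteProbs : ContinuousOn finiteProbs rankedLaws := by
  refine continuousOn_pi.2 fun c => ?_
  have hlim : Tendsto (fun m : ℕ => (c.1 : ℝ) ^ 2 * (4 / (m + 1))) atTop (𝓝 0) := by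
    convert tendsto_one_div_add_atTop_nhds_zero_nat.const_mul ((c.1 : ℝ) ^ 2 * 4) using 2 <;> ring
  have hunif : TendstoUniformlyOn (fun (m : ℕ) μ => truncProbs m μ c) (finiteProbs · c) atTop
      rankedLaws := by
    refine Metric.tendstoUniformlyOn_iff.2 fun ε hε => ?_
    filter_upwards [hlim.eventually_lt_const hε] with m hm μ hμ
    exact (abs_finiteProbs_sub_truncProbs_le hμ m c).trans_lt hm
  exact hunif.continuousOn (.of_forall fun m =>
    ((continuous_apply c).comp (continuous_truncProbs m)).continuousOn)

/-! ### Borel structure of the ranked simplex -/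

theorem measurable_borel_toMeasure {E : Type*} [TopologicalSpace E] [HasOuterApproxClosed E]
    [MeasurableSpace E] [BorelSpace E] :
    Measurable[borel _] ((↑) : ProbabilityMeasure E → Measure E) := by
  borelize (ProbabilityMeasure E)
  refine .measure_of_isPiSystem_of_isProbabilityMeasure (BorelSpace.measurable_eq (α := E))
    isPiSystem_isOpen fun U hU => ?_
  have hlsc : LowerSemicontinuous fun μ : ProbabilityMeasure E => (μ : Measure E) U :=
    lowerSemicontinuous_iff_le_liminf.2 fun μ =>
      ProbabilityMeasure.le_liminf_measure_open_of_tendsto (tendsto_id (x := 𝓝 μ)) hU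
  exact hlsc.measurable

theorem borelSpace_of_measurable_injective {X Z : Type*} [TopologicalSpace X] [PolishSpace X]
    [mX : MeasurableSpace X] [MeasurableSpace Z] [MeasurableSpace.CountablySeparated Z]
    (hle : mX ≤ borel X) {f : X → Z} (hf : Measurable f) (hinj : Function.Injective f) :
    BorelSpace X := by
  have hstd : @StandardBorelSpace X (borel X) := by
    let : MeasurableSpace X := borel X
    have : BorelSpace X := ⟨rfl⟩
    infer_instance
  have hemb : @MeasurableEmbedding X Z (borel X) _ f :=
    @Measurable.measurableEmbedding X Z _ f _ (borel X) hstd (hf.mono hle le_rfl) hinj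
  have hcomap := @MeasurableEmbedding.comap_eq X Z (borel X) _ f hemb
  exact ⟨le_antisymm hle (hcomap.symm.trans_le hf.comap_le)⟩

theorem exists_countable_isPiSystem_generateFrom {E : Type*} [m : MeasurableSpace E]
    [MeasurableSpace.CountablyGenerated E] : ∃ C : Set (Set E), C.Countable ∧ IsPiSystem C ∧
      m = .generateFrom C := by
  obtain ⟨b, hb, rfl⟩ := MeasurableSpace.CountablyGenerated.isCountablyGenerated (α := E)
  exact ⟨generateSetAlgebra b, countable_generateSetAlgebra hb,
    isSetAlgebra_generateSetAlgebra.isSetRing.isSetSemiring.isPiSystem,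
    generateFrom_generateSetAlgebra_eq.symm⟩

instance borelSpace_probabilityMeasure {E : Type*} [TopologicalSpace E]
    [TopologicalSpace.MetrizableSpace E] [CompactSpace E] [MeasurableSpace E] [BorelSpace E] :
    BorelSpace (ProbabilityMeasure E) := by
  obtain ⟨C, hC, hpi, hgen⟩ := exists_countable_isPiSystem_generateFrom (E := E)
  have := hC.to_subtype
  let ev : ProbabilityMeasure E → C → ENNReal := fun μ A => (μ : Measure E) A
  have hev : Measurable ev := measurable_pi_lambda _ fun A => by
    have hA : MeasurableSet (A : Set E) := hgen ▸ MeasurableSpace.measurableSet_generateFrom A.2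
    exact (Measure.measurable_coe hA).comp measurable_subtype_coe
  have hinj : Function.Injective ev := fun μ ν h => by
    have huniv : (μ : Measure E) univ = (ν : Measure E) univ := by simp
    exact Subtype.ext <| ext_of_generate_finite (μ := (μ : Measure E)) C hgen hpi
      (fun A hA => congrFun h ⟨A, hA⟩) huniv
  let := TopologicalSpace.metrizableSpaceMetric (ProbabilityMeasure E)
  exact borelSpace_of_measurable_injective measurable_borel_toMeasure.comap_le hev hinj

theorem toLex_lt_iff_exists_add_le {x y : ℕ → ℝ} : toLex x < toLex y ↔
    ∃ n k : ℕ, (∀ m < n, x m = y m) ∧ x n + 1 / (k + 1) ≤ y n := by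
  constructor
  · rintro ⟨n, heq, hlt⟩
    obtain ⟨k, hk⟩ := exists_nat_one_div_lt (sub_pos.2 hlt)
    exact ⟨n, k, heq, (lt_sub_iff_add_lt'.1 hk).le⟩
  · rintro ⟨n, k, heq, hle⟩
    exact ⟨n, heq, (lt_add_of_pos_right _ Nat.one_div_pos_of_nat).trans_le hle⟩

theorem toLex_le_iff_forall_not_add_le {x y : ℕ → ℝ} : toLex y ≤ toLex x ↔
    ¬∃ n k : ℕ, (∀ m < n, x m = y m) ∧ x n + 1 / (k + 1) ≤ y n :=
  not_lt.symm.trans (not_congr toLex_lt_iff_exists_add_le)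

theorem isClosed_add_le (n k : ℕ) : IsClosed {p : (ℕ → ℝ) × (ℕ → ℝ) |
    (∀ m < n, p.1 m = p.2 m) ∧ p.1 n + 1 / (k + 1) ≤ p.2 n} := by
  simp only [ofPred_and, ofPred_forall]
  refine .inter (isClosed_iInter fun m => isClosed_iInter fun _ => isClosed_eq ?_ ?_)
    (isClosed_le ?_ ?_) <;> fun_prop

/-- The points of `K` at which `c` is lexicographically maximal within their fiber of `φ`. They
select one value of `c` from each fiber. -/
def fiberLexMax {X Z : Type*} (K : Set X) (φ : X → Z) (c : X → ℕ → ℝ) : Set X :=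
  {x ∈ K | ∀ y ∈ K, φ y = φ x → toLex (c y) ≤ toLex (c x)}

section FiberLexMax

variable {X Z : Type*} [TopologicalSpace X] [T2Space X] [TopologicalSpace Z] [T2Space Z]
  {K : Set X} {φ : X → Z} {c : X → ℕ → ℝ}

theorem exists_mem_fiberLexMax (hK : IsCompact K) (hφ : ContinuousOn φ K) (hc : Continuous c)
    {x : X} (hx : x ∈ K) : ∃ y ∈ fiberLexMax K φ c, φ y = φ x := by
  have hfiber : IsCompact (K ∩ φ ⁻¹' {φ x}) :=
    hK.of_isClosed_subset (hφ.preimage_isClosed_of_isClosed hK.isClosed isClosed_singleton)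
      inter_subset_left
  obtain ⟨-, ⟨y, ⟨hy, hyx⟩, rfl⟩, hmax⟩ :=
    exists_isMaxOn_toLex (hfiber.image hc) ⟨c x, x, ⟨hx, rfl⟩, rfl⟩
  exact ⟨y, ⟨hy, fun z hz hzy => hmax ⟨z, ⟨hz, hzy.trans hyx⟩, rfl⟩⟩, hyx⟩

/-- The complement in `K` is a countable union of projections of compact sets of pairs. -/
theorem measurableSet_fiberLexMax [MeasurableSpace X] [OpensMeasurableSpace X]
    (hK : IsCompact K) (hφ : ContinuousOn φ K) (hc : Continuous c) :
    MeasurableSet (fiberLexMax K φ c) := by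
  let Q : ℕ → ℕ → Set (X × X) := fun n k => (K ×ˢ K ∩ {p | φ p.1 = φ p.2}) ∩
    {p | (∀ m < n, c p.1 m = c p.2 m) ∧ c p.1 n + 1 / (k + 1) ≤ c p.2 n}
  have hfiber : IsClosed (K ×ˢ K ∩ {p | φ p.1 = φ p.2}) :=
    ((hφ.comp continuousOn_fst fun p hp => hp.1).prodMk
      (hφ.comp continuousOn_snd fun p hp => hp.2)).preimage_isClosed_of_isClosed
      (hK.isClosed.prod hK.isClosed) isClosed_diagonal
  have hQ : ∀ n k, IsCompact (Q n k) := fun n k =>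
    ((hK.prod hK).of_isClosed_subset hfiber inter_subset_left).inter_right
      ((isClosed_add_le n k).preimage (hc.prodMap hc))
  have heq : fiberLexMax K φ c = K \ ⋃ n, ⋃ k, Prod.fst '' Q n k := by
    ext x
    simp only [fiberLexMax, toLex_le_iff_forall_not_add_le, Set.mem_sdiff, mem_ofPred_eq,
      mem_iUnion, Q]
    refine and_congr_right fun hx => ⟨?_, ?_⟩
    · rintro h ⟨n, k, ⟨x, y⟩, ⟨⟨hxy, hφxy⟩, hlt⟩, rfl⟩
      exact h y hxy.2 hφxy.symm ⟨n, k, hlt⟩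
    · rintro h y hy hφ ⟨n, k, hlt⟩
      exact h ⟨n, k, (x, y), ⟨⟨⟨hx, hy⟩, hφ.symm⟩, hlt⟩, rfl⟩
  rw [heq]
  exact hK.measurableSet.diff <| .iUnion fun n => .iUnion fun k =>
    ((hQ n k).image continuous_fst).measurableSet

end FiberLexMax

theorem measurable_law : Measurable law := by
  suffices h : Measurable fun f => (law f : Measure ProperPair) from h.subtype_mk
  refine Measure.measurable_of_measurable_coe _ fun A _ => ?_
  have hmass : ∀ s : ProperPair, Measurable fun f : PairSimplex => f.mass s.pair := fun s =>
    (measurable_pi_apply s.pair).comp PairSimplex.continuous_mass.measurable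
  simp only [← Measure.tsum_indicator_apply_singleton _ A .of_discrete, law_singleton]
  exact .tsum fun s => by
    by_cases hs : s ∈ A <;> simp only [hs, indicator_of_mem, indicator_of_notMem, not_false_iff]
    exacts [(hmass s).ennreal_ofReal, measurable_const]

theorem measurable_ofLaw : Measurable ofLaw := by
  have hmass : Measurable fun μ => (ofLaw μ).mass := measurable_pi_lambda _ fun _ =>
    ((Measure.measurable_coe .of_discrete).comp measurable_subtype_coe).ennreal_toReal
  rw [measurable_iff_comap_le] at hmass ⊢
  refine le_of_eq_of_le ?_ hmass
  rw [← Function.comp_def PairSimplex.mass ofLaw, ← MeasurableSpace.comap_comp]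
  exact congrArg _ PairSimplex.measurableSpace_eq

/-- Elements of the simplex correspond to distributions of proper pairs. -/
noncomputable def lawEquiv : PairSimplex ≃ᵐ ProbabilityMeasure ProperPair where
  toFun := law
  invFun := ofLaw
  left_inv _ := law_injective (law_ofLaw _)
  right_inv := law_ofLaw
  measurable_toFun := measurable_law
  measurable_invFun := measurable_ofLaw

instance : StandardBorelSpace (ProbabilityMeasure ProperPair) := by
  let := TopologicalSpace.metrizableSpaceMetric (ProbabilityMeasure ProperPair)
  infer_instance

theorem standardBorelSpace_of_measurableEquiv {X Z : Type*} [mX : MeasurableSpace X]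
    [MeasurableSpace Z] [StandardBorelSpace Z] (e : X ≃ᵐ Z) : StandardBorelSpace X := by
  obtain ⟨_, _, _⟩ := StandardBorelSpace.polish (α := Z)
  refine ⟨.induced e inferInstance, @BorelSpace.mk _ (_) _ ?_, e.toEquiv.polishSpace_induced⟩
  exact e.measurableEmbedding.comap_eq.symm.trans
    ((congrArg (MeasurableSpace.comap _) BorelSpace.measurable_eq).trans borel_comap.symm)

instance : StandardBorelSpace PairSimplex := standardBorelSpace_of_measurableEquiv lawEquiv

theorem continuous_lexCoord_ofLaw : Continuous fun μ => (ofLaw μ).lexCoord :=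
  continuous_pi fun _ => continuous_measureReal_of_isClopen
    (ProperPair.isClopen_pair_eq (by omega) (by omega))

theorem isReordering_iff_networkLaw_eq {f g : PairSimplex} :
    f.IsReordering g ↔ networkLaw f = networkLaw g :=
  ⟨PairSimplex.IsReordering.networkLaw_eq, isReordering_of_networkLaw_eq⟩

theorem mem_rankedSimplex_iff {f : PairSimplex} : f ∈ RankedSimplex ↔
    law f ∈ fiberLexMax rankedLaws finiteProbs fun μ => (ofLaw μ).lexCoord := by
  refine and_congr law_mem_rankedLaws_iff.symm (lawEquiv.toEquiv.forall_congr fun {g} => ?_)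
  change _ ↔ (law g ∈ rankedLaws → finiteProbs (law g) = finiteProbs (law f) →
    toLex (ofLaw (law g)).lexCoord ≤ toLex (ofLaw (law f)).lexCoord)
  rw [law_mem_rankedLaws_iff, finiteProbs_law_eq_iff, isReordering_iff_networkLaw_eq,
    PairSimplex.lexBefore_iff, law_injective (law_ofLaw (law f)),
    law_injective (law_ofLaw (law g)), ← not_lt]
  tauto

theorem measurableSet_rankedSimplex : MeasurableSet RankedSimplex := by
  have heq : RankedSimplex =
      law ⁻¹' fiberLexMax rankedLaws finiteProbs fun μ => (ofLaw μ).lexCoord :=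
    ext fun _ => mem_rankedSimplex_iff
  rw [heq]
  exact measurable_law <| measurableSet_fiberLexMax isCompact_rankedLaws continuousOn_finiteProbs
    continuous_lexCoord_ofLaw

theorem exists_mem_rankedSimplex {μ : ProbabilityMeasure ProperPair} (hμ : μ ∈ rankedLaws) :
    ∃ g ∈ RankedSimplex, finiteProbs (law g) = finiteProbs μ := by
  obtain ⟨ν, hν, h⟩ := exists_mem_fiberLexMax isCompact_rankedLaws continuousOn_finiteProbs
    continuous_lexCoord_ofLaw hμ
  refine ⟨ofLaw ν, mem_rankedSimplex_iff.2 ?_, ?_⟩ <;> rwa [law_ofLaw]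

instance : StandardBorelSpace RankedSimplex := measurableSet_rankedSimplex.standardBorel

/-- The probabilities of finite networks as a function on the ranked simplex. -/
noncomputable def rankedProbs (f : RankedSimplex) : (Σ n, Network (Fin n)) → ℝ :=
  finiteProbs (law f)

theorem range_rankedProbs : range rankedProbs = finiteProbs '' rankedLaws := by
  refine (range_subset_iff.2 fun f => ?_).antisymm (image_subset_iff.2 fun μ hμ => ?_)
  · exact mem_image_of_mem _ (law_mem_rankedLaws_iff.2 f.2.1)
  · obtain ⟨g, hg, h⟩ := exists_mem_rankedSimplex hμ
    exact ⟨⟨g, hg⟩, h⟩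

theorem isCompact_range_rankedProbs : IsCompact (range rankedProbs) :=
  range_rankedProbs ▸ isCompact_rankedLaws.image_of_continuousOn continuousOn_finiteProbs

instance : CompactSpace (range rankedProbs) :=
  isCompact_iff_compactSpace.1 isCompact_range_rankedProbs

theorem measurable_rankedProbs : Measurable rankedProbs :=
  (continuousOn_iff_continuous_domRestrict.1 continuousOn_finiteProbs).measurable.comp
    ((measurable_law.comp measurable_subtype_coe).subtype_mk
      (h := fun f => law_mem_rankedLaws_iff.2 f.2.1))

theorem rankedProbs_injective : Function.Injective rankedProbs := fun f g h =>
  Subtype.ext (eq_of_networkLaw_eq f.2 g.2 (finiteProbs_law_eq_iff.1 h))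

/-- The ranked simplex is Borel isomorphic to a compact space, by the Lusin-Souslin theorem. -/
noncomputable def rankedEquiv : RankedSimplex ≃ᵐ range rankedProbs :=
  (measurable_rankedProbs.measurableEmbedding rankedProbs_injective).equivRange

theorem rankedEquiv_apply (f : RankedSimplex) (c : Σ n, Network (Fin n)) :
    (rankedEquiv f).1 c = (networkLaw (f : PairSimplex)).real (cylinderSet c.1 {c.2}) :=
  (networkLaw_real_cylinderSet f c).symm ▸
    congrFun (congrArg Subtype.val (MeasurableEmbedding.equivRange_apply _ f)) c

/-! ### Uniqueness of the mixing measure -/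

theorem measure_ext_of_submonoid {X : Type*} [TopologicalSpace X] [PolishSpace X]
    [MeasurableSpace X] [BorelSpace X] {μ ν : Measure X} [IsFiniteMeasure μ] [IsFiniteMeasure ν]
    (S : Submonoid (BoundedContinuousFunction X ℝ))
    (hS : ∀ x y, x ≠ y → ∃ g ∈ S, g x ≠ g y) (h : ∀ g ∈ S, ∫ x, g x ∂μ = ∫ x, g x ∂ν) :
    μ = ν := by
  let A : StarSubalgebra ℝ (BoundedContinuousFunction X ℝ) :=
    { Algebra.adjoin ℝ (S : Set (BoundedContinuousFunction X ℝ)) with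
      star_mem' := fun {g} hg => by
        rwa [show star g = g from BoundedContinuousFunction.ext fun x => star_trivial (g x)] }
  refine ext_of_forall_mem_subalgebra_integral_eq_of_polish (𝕜 := ℝ) (A := A) ?_ fun g hg => ?_
  · intro x y hxy
    obtain ⟨g, hg, hne⟩ := hS x y hxy
    exact ⟨g, ⟨g.toContinuousMap, ⟨g, Algebra.subset_adjoin hg, rfl⟩, rfl⟩, hne⟩
  · replace hg : g ∈ Submodule.span ℝ (S : Set (BoundedContinuousFunction X ℝ)) := by
      rwa [← Submonoid.closure_eq S, ← Algebra.adjoin_eq_span, Subalgebra.mem_toSubmodule]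
    induction hg using Submodule.span_induction with
    | mem g hg => exact h g hg
    | zero => simp
    | add g₁ g₂ _ _ h₁ h₂ =>
      simp only [BoundedContinuousFunction.add_apply]
      rw [integral_add (g₁.integrable μ) (g₂.integrable μ),
        integral_add (g₁.integrable ν) (g₂.integrable ν), h₁, h₂]
    | smul a g _ h =>
      simp only [BoundedContinuousFunction.smul_apply, integral_smul, h]

instance : PolishSpace (range rankedProbs) := isCompact_range_rankedProbs.isClosed.polishSpace

/-- A coordinate on the compact space of probabilities of finite networks. -/
noncomputable def coordFunction (c : Σ n, Network (Fin n)) :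
    BoundedContinuousFunction (range rankedProbs) ℝ :=
  .mkOfCompact ⟨fun y => y.1 c, (continuous_apply c).comp continuous_subtype_val⟩

theorem coordFunction_rankedEquiv (c : Σ n, Network (Fin n)) (f : RankedSimplex) :
    coordFunction c (rankedEquiv f) =
      (networkLaw (f : PairSimplex)).real (cylinderSet c.1 {c.2}) :=
  rankedEquiv_apply f c

theorem measurable_networkLaw :
    Measurable fun f : RankedSimplex => networkLaw (f : PairSimplex) := by
  refine .measure_of_isPiSystem_of_isProbabilityMeasure generateFrom_cylinderSet
    isPiSystem_cylinderSet ?_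
  rintro _ ⟨n, A, rfl⟩
  have hsum : ∀ f : RankedSimplex, networkLaw (f : PairSimplex) (cylinderSet n A) =
      ∑' E : A, ENNReal.ofReal (coordFunction ⟨n, E⟩ (rankedEquiv f)) := fun f => by
    simp only [coordFunction_rankedEquiv, ofReal_measureReal (measure_ne_top _ _)]
    exact (tsum_measure_preimage_singleton A.to_countable fun E _ =>
      measurableSet_cylinderSet n {E}).symm
  simp only [hsum]
  exact .tsum fun E => ((coordFunction _).continuous.measurable.comp
    rankedEquiv.measurable).ennreal_ofReal

theorem integral_map_rankedEquiv {φ : Measure RankedSimplex} {B : Set (Network ℕ)}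
    (hB : MeasurableSet B) {g : range rankedProbs → ℝ}
    (hg : ∀ f : RankedSimplex, g (rankedEquiv f) = (networkLaw (f : PairSimplex)).real B) :
    ∫ y, g y ∂φ.map rankedEquiv =
      (∫⁻ f : RankedSimplex, networkLaw (f : PairSimplex) B ∂φ).toReal := by
  simp only [integral_map_equiv, hg]
  exact integral_toReal ((Measure.measurable_coe hB).comp measurable_networkLaw).aemeasurable
    (ae_of_all _ fun f => measure_lt_top _ _)

/-- The continuous functions on the range of `rankedProbs` that correspond to probabilities of
cylinder sets. They are closed under multiplication because disjoint groups of edges are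
independent under every `networkLaw f`. -/
def cylinderFunctions : Submonoid (BoundedContinuousFunction (range rankedProbs) ℝ) where
  carrier := {g | ∃ n A, ∀ f : RankedSimplex,
    g (rankedEquiv f) = (networkLaw (f : PairSimplex)).real (cylinderSet n A)}
  one_mem' := ⟨0, univ, fun f => by simp [cylinderSet]⟩
  mul_mem' := by
    rintro g h ⟨m, A, hg⟩ ⟨n, B, hh⟩
    exact ⟨m + n, _, fun f => (congrArg₂ (· * ·) (hg f) (hh f)).trans <|
      ENNReal.toReal_mul.symm.trans (congrArg _ (networkLaw_cylinderSet_mul f m n A B))⟩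

theorem mixing_measure_unique {φ ψ : Measure RankedSimplex} [IsProbabilityMeasure φ]
    [IsProbabilityMeasure ψ]
    (h : ∀ B, MeasurableSet B → ∫⁻ f : RankedSimplex, networkLaw (f : PairSimplex) B ∂φ =
      ∫⁻ f : RankedSimplex, networkLaw (f : PairSimplex) B ∂ψ) : φ = ψ := by
  have := Measure.isProbabilityMeasure_map (μ := φ) rankedEquiv.measurable.aemeasurable
  have := Measure.isProbabilityMeasure_map (μ := ψ) rankedEquiv.measurable.aemeasurable
  have hmap : φ.map rankedEquiv = ψ.map rankedEquiv := by
    refine measure_ext_of_submonoid cylinderFunctions (fun x y hxy => ?_) ?_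
    · obtain ⟨c, hc⟩ := Function.ne_iff.1 (Subtype.coe_injective.ne hxy)
      exact ⟨coordFunction c, ⟨c.1, {c.2}, coordFunction_rankedEquiv c⟩, hc⟩
    · rintro g ⟨n, A, hg⟩
      have hB := measurableSet_cylinderSet n A
      rw [integral_map_rankedEquiv hB hg, integral_map_rankedEquiv hB hg, h _ hB]
  exact rankedEquiv.map_measurableEquiv_injective hmap

/-! ### Sampling from a finite network -/

theorem exists_bijOn_Icc_antitone {ι β : Type*} [LinearOrder β] (s : Finset ι) (w : ι → β) :
    ∃ ρ : ι → ℤ, BijOn ρ s (Icc 1 s.card) ∧ ∀ u ∈ s, ∀ v ∈ s, ρ u ≤ ρ v → w v ≤ w u := by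
  classical
  induction s using Finset.induction_on_min_value w with
  | empty => exact ⟨0, by simp, by simp⟩
  | insert a s ha hmin ih =>
    obtain ⟨ρ, hρ, hanti⟩ := ih
    let ρ' := Function.update ρ a (s.card + 1)
    have ha' : ρ' a = s.card + 1 := Function.update_self ..
    have hs' : EqOn ρ' ρ s := fun v hv => Function.update_of_ne (ne_of_mem_of_not_mem hv ha) ..
    have hle : ∀ v ∈ s, ρ' v ≤ s.card := fun v hv => hs' hv ▸ (hρ.mapsTo hv).2
    refine ⟨ρ', ?_, ?_⟩
    · have hcard : (s.card : ℤ) + 1 ∉ Icc (1 : ℤ) s.card := by simp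
      have hIcc : Icc (1 : ℤ) (insert a s).card = insert (ρ' a) (Icc (1 : ℤ) s.card) := by
        rw [ha', Finset.card_insert_of_notMem ha]
        ext i
        simp only [mem_Icc, mem_insert_iff]
        omega
      rw [hIcc, Finset.coe_insert]
      exact (hs'.symm.bijOn_iff.1 hρ).insert (ha'.symm ▸ hcard)
    · simp only [Finset.mem_insert]
      rintro u (rfl | hu) v (rfl | hv) huv
      · rfl
      · have := hle v hv
        omega
      · exact hmin u hu
      · exact hanti u hu v hv (by rwa [← hs' hu, ← hs' hv])

theorem finite_vertices {T : Type} [Finite T] (I : Interactions T) : I.vertices.Finite := by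
  have hunion : I.vertices = ⋃ k, {v | v ∈ I k} := by
    ext
    simp [Interactions.vertices]
  rw [hunion]
  refine finite_iUnion fun k => ?_
  induction I k with | _ a b
  exact (toFinite {a, b}).subset fun v hv => by simpa using hv

theorem exists_ranked_representative {T : Type} [Finite T] [MeasurableSpace T] (μ : Measure T)
    (E : Network T) : ∃ X : T → ProperPair, (∀ k, ∀ i ∈ (X k).pair, 1 ≤ i) ∧
      inducedNetwork (fun k => (X k).pair) = E ∧
      ∀ i : ℤ, 1 ≤ i → μ.real {k | i + 1 ∈ (X k).pair} ≤ μ.real {k | i ∈ (X k).pair} := by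
  obtain ⟨I, rfl⟩ := Quotient.exists_rep E
  obtain ⟨ρ, hρ, hanti⟩ := exists_bijOn_Icc_antitone (finite_vertices I).toFinset
    fun v => μ.real {k | v ∈ I k}
  simp only [Finite.coe_toFinset, Finite.mem_toFinset] at hρ hanti
  have hpos : ∀ k, ∀ i ∈ (I k).map ρ, 1 ≤ i := fun k i hi => by
    obtain ⟨v, hv, rfl⟩ := Sym2.mem_map.1 hi
    exact (hρ.mapsTo ⟨k, hv⟩).1
  have hmem : ∀ v ∈ I.vertices, {k | ρ v ∈ (I k).map ρ} = {k | v ∈ I k} := fun v hv => by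
    ext k
    refine ⟨fun h => ?_, fun h => Sym2.mem_map.2 ⟨v, h, rfl⟩⟩
    obtain ⟨u, hu, huv⟩ := Sym2.mem_map.1 h
    exact hρ.injOn ⟨k, hu⟩ hv huv ▸ hu
  refine ⟨fun k => ⟨(I k).map ρ, fun i hi => by have := hpos k i hi; omega,
    fun h => by have := hpos k _ h; omega⟩, hpos,
    (inducedNetwork_eq_iff.2 ⟨ρ, hρ.injOn, fun _ => rfl⟩).symm, fun i hi => ?_⟩
  obtain hempty | ⟨k, hk⟩ := {k | i + 1 ∈ (I k).map ρ}.eq_empty_or_nonempty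
  · rw [hempty, measureReal_empty]
    exact measureReal_nonneg
  · obtain ⟨v, hv, hvi⟩ := Sym2.mem_map.1 hk
    have hv' : v ∈ I.vertices := ⟨k, hv⟩
    have hle := (hρ.mapsTo hv').2
    obtain ⟨u, hu, rfl⟩ := hρ.surjOn (⟨hi, by omega⟩ : i ∈ Icc 1 _)
    simp only [← hvi, hmem u hu, hmem v hv']
    exact hanti u hu v hv' (by omega)

theorem networkOf_of_one_le {S : Type} [Encodable S] {X : S → ProperPair}
    (h : ∀ k, ∀ i ∈ (X k).pair, 1 ≤ i) : networkOf X = inducedNetwork fun k => (X k).pair := by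
  refine congrArg inducedNetwork (funext fun k => ?_)
  exact (Sym2.map_congr fun i hi => if_pos (h k i hi)).trans (congrFun Sym2.map_id _)

/-- Sampling the edges of a finite network with replacement is a process of the form
`networkLaw f`. -/
theorem exists_networkLaw_eq_pi {T : Type} [Finite T] [MeasurableSpace T]
    [DiscreteMeasurableSpace T] (μ : Measure T) [IsProbabilityMeasure μ] (E : Network T) :
    ∃ f : RankedSimplex, ∀ c : Σ n, Network (Fin n),
      (networkLaw (f : PairSimplex)).real (cylinderSet c.1 {c.2}) =
        (Measure.pi fun _ : Fin c.1 => μ).real {u | E.pullback u = c.2} := by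
  obtain ⟨X, hpos, rfl, hanti⟩ := exists_ranked_representative μ E
  have hX : Measurable X := .of_discrete
  have := Measure.isProbabilityMeasure_map (μ := μ) hX.aemeasurable
  let ν : ProbabilityMeasure ProperPair := ⟨μ.map X, this⟩
  have hν : ν ∈ rankedLaws := fun i hi => by
    simpa only [ν, ProbabilityMeasure.coe_mk, map_measureReal_apply hX .of_discrete,
      preimage_ofPred_eq] using hanti i hi
  obtain ⟨g, hg, h⟩ := exists_mem_rankedSimplex hν
  refine ⟨⟨g, hg⟩, fun c => ?_⟩
  rw [networkLaw_real_cylinderSet, h, finiteProbs]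
  change (Measure.pi fun _ : Fin c.1 => μ.map X).real _ = _
  rw [← Measure.pi_map_pi fun _ => hX.aemeasurable,
    map_measureReal_apply (by fun_prop) (to_countable _).measurableSet]
  simp only [preimage_ofPred_eq, networkOf_of_one_le fun _ => hpos _]
  rfl

/-! ### Existence of the mixing measure -/

theorem EdgeExchangeable.measure_pullback {Ω : Type*} [MeasurableSpace Ω] {P : Measure Ω}
    {Y : Ω → Network ℕ} (hY : Measurable Y) (h : EdgeExchangeable P Y) {n : ℕ} {u : Fin n → ℕ}
    (hu : Function.Injective u) (F : Network (Fin n)) :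
    P {ω | (Y ω).pullback u = F} = P (Y ⁻¹' cylinderSet n {F}) := by
  obtain ⟨σ, hσ⟩ := (Equiv.Perm.isMultiplyPretransitive ℕ n).exists_smul_eq
    (⟨Fin.val, Fin.val_injective⟩ : Fin n ↪ ℕ) ⟨u, hu⟩
  have hσu : σ ∘ Fin.val = u := funext fun k => DFunLike.congr_fun hσ k
  have hcyl := DFunLike.congr_fun (h σ.symm) (cylinderSet n {F})
  have hrel : Measurable fun ω => (Y ω).relabel σ.symm := (measurable_pullback _).comp hY
  rw [Measure.map_apply hrel (measurableSet_cylinderSet _ _),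
    Measure.map_apply hY (measurableSet_cylinderSet _ _)] at hcyl
  rw [← hcyl, ← hσu]
  simp only [← Network.pullback_pullback]
  rfl

theorem integral_measureReal_swap {α β : Type*} [MeasurableSpace α] [MeasurableSpace β]
    (μ : Measure α) (ν : Measure β) [IsFiniteMeasure μ] [IsFiniteMeasure ν] {A : Set (α × β)}
    (hA : MeasurableSet A) :
    ∫ x, ν.real (Prod.mk x ⁻¹' A) ∂μ = ∫ y, μ.real ((·, y) ⁻¹' A) ∂ν := by
  simp only [measureReal_def]
  rw [integral_toReal (measurable_measure_prodMk_left hA).aemeasurable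
      (ae_of_all _ fun _ => measure_lt_top _ _),
    integral_toReal (measurable_measure_prodMk_right hA).aemeasurable
      (ae_of_all _ fun _ => measure_lt_top _ _)]
  exact congrArg ENNReal.toReal ((Measure.prod_apply hA).symm.trans (Measure.prod_apply_symm hA))

theorem EdgeExchangeable.abs_integral_sub_le {Ω : Type*} [MeasurableSpace Ω] {P : Measure Ω}
    [IsProbabilityMeasure P] {Y : Ω → Network ℕ} (hY : Measurable Y) (h : EdgeExchangeable P Y)
    {T : Type} [Finite T] [MeasurableSpace T] [DiscreteMeasurableSpace T] (μ : Measure T)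
    [IsProbabilityMeasure μ] {e : T → ℕ} (he : Function.Injective e) {n : ℕ}
    (F : Network (Fin n)) :
    |∫ ω, (Measure.pi fun _ : Fin n => μ).real {u | ((Y ω).pullback e).pullback u = F} ∂P -
        P.real (Y ⁻¹' cylinderSet n {F})| ≤
      (Measure.pi fun _ : Fin n => μ).real {u | ¬ Function.Injective u} := by
  let ν := Measure.pi fun _ : Fin n => μ
  have hA : MeasurableSet {p : Ω × (Fin n → T) | ((Y p.1).pullback e).pullback p.2 = F} := by
    refine measurable_from_prod_countable_left (f := fun p : Ω × (Fin n → T) =>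
      ((Y p.1).pullback e).pullback p.2) (fun u A _ => ?_) (measurableSet_singleton F)
    simp only [Network.pullback_pullback]
    exact hY (measurableSet_pullback_mem (e ∘ u) A)
  have hpoint : ∀ u : Fin n → T, |P.real {ω | ((Y ω).pullback e).pullback u = F} -
      P.real (Y ⁻¹' cylinderSet n {F})| ≤
      {u | ¬ Function.Injective u}.indicator (1 : (Fin n → T) → ℝ) u := fun u => by
    by_cases hu : Function.Injective u
    · simp [Network.pullback_pullback, measureReal_def, h.measure_pullback hY (he.comp hu), hu]
    · simpa [hu] using abs_sub_le_of_nonneg_of_le measureReal_nonneg measureReal_le_one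
        measureReal_nonneg measureReal_le_one
  have hswap : ∫ ω, ν.real {u | ((Y ω).pullback e).pullback u = F} ∂P =
      ∫ u, P.real {ω | ((Y ω).pullback e).pullback u = F} ∂ν := integral_measureReal_swap P ν hA
  calc |∫ ω, ν.real {u | ((Y ω).pullback e).pullback u = F} ∂P -
        P.real (Y ⁻¹' cylinderSet n {F})|
      = |∫ u, (P.real {ω | ((Y ω).pullback e).pullback u = F} -
          P.real (Y ⁻¹' cylinderSet n {F})) ∂ν| := by
        rw [integral_sub .of_finite .of_finite, hswap, integral_const, probReal_univ, one_smul]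
    _ ≤ ∫ u, |P.real {ω | ((Y ω).pullback e).pullback u = F} -
          P.real (Y ⁻¹' cylinderSet n {F})| ∂ν := abs_integral_le_integral_abs
    _ ≤ ∫ u, {u | ¬ Function.Injective u}.indicator (1 : (Fin n → T) → ℝ) u ∂ν :=
        integral_mono .of_finite .of_finite hpoint
    _ = ν.real {u | ¬ Function.Injective u} := integral_indicator_one (to_countable _).measurableSet

theorem uniformOn_univ_real_singleton {T : Type*} [Fintype T] [MeasurableSpace T]
    [MeasurableSingletonClass T] (a : T) :
    (ProbabilityTheory.uniformOn univ).real {a} = (Fintype.card T : ℝ)⁻¹ := by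
  simp [measureReal_def, ProbabilityTheory.uniformOn_univ]

theorem EdgeExchangeable.tendsto_integral_restrict_pullback {Ω : Type*} [MeasurableSpace Ω]
    {P : Measure Ω} [IsProbabilityMeasure P] {Y : Ω → Network ℕ} (hY : Measurable Y)
    (h : EdgeExchangeable P Y) {n : ℕ} (F : Network (Fin n)) :
    Tendsto (fun N : ℕ => ∫ ω, (Measure.pi fun _ : Fin n =>
        ProbabilityTheory.uniformOn (univ : Set (Fin (N + 1)))).real
          {u | ((Y ω).restrict (N + 1)).pullback u = F} ∂P)
      atTop (𝓝 (P.real (Y ⁻¹' cylinderSet n {F}))) := by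
  have hcollision : ∀ N : ℕ, (Measure.pi fun _ : Fin n =>
      ProbabilityTheory.uniformOn (univ : Set (Fin (N + 1)))).real
        {u | ¬ Function.Injective u} ≤ n ^ 2 * (1 / (N + 1)) := fun N => by
    have hle := pi_real_exists_ne_rel_le (ι := Fin n) (R := fun a b => b = a) fun a =>
      (uniformOn_univ_real_singleton (T := Fin (N + 1)) a).le
    simpa [Function.Injective, and_comm, eq_comm] using hle
  have hlim : Tendsto (fun N : ℕ => (n : ℝ) ^ 2 * (1 / (N + 1))) atTop (𝓝 0) := by
    simpa only [mul_zero] using tendsto_one_div_add_atTop_nhds_zero_nat.const_mul ((n : ℝ) ^ 2)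
  exact tendsto_iff_dist_tendsto_zero.2 <| squeeze_zero (fun _ => dist_nonneg)
    (fun N => (h.abs_integral_sub_le hY _ Fin.val_injective F).trans (hcollision N)) hlim

theorem exists_integral_eq_of_tendsto {X : Type*} [TopologicalSpace X] [CompactSpace X]
    [TopologicalSpace.MetrizableSpace X] [MeasurableSpace X] [BorelSpace X]
    (ν : ℕ → ProbabilityMeasure X) :
    ∃ μ : ProbabilityMeasure X, ∀ (g : BoundedContinuousFunction X ℝ) (a : ℝ),
      Tendsto (fun N => ∫ x, g x ∂(ν N : Measure X)) atTop (𝓝 a) →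
        ∫ x, g x ∂(μ : Measure X) = a := by
  obtain ⟨μ, -, hμ⟩ := isCompact_univ.ultrafilter_le_nhds ((hyperfilter ℕ).map ν) (by simp)
  have hlim := ProbabilityMeasure.tendsto_iff_forall_integral_tendsto.1 hμ
  exact ⟨μ, fun g a ha => tendsto_nhds_unique (hlim g) (ha.mono_left Nat.hyperfilter_le_atTop)⟩

theorem EdgeExchangeable.exists_integral_coordFunction {Ω : Type*} [MeasurableSpace Ω]
    {P : Measure Ω} [IsProbabilityMeasure P] {Y : Ω → Network ℕ} (hY : Measurable Y)
    (h : EdgeExchangeable P Y) :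
    ∃ μ : ProbabilityMeasure (range rankedProbs), ∀ c : Σ n, Network (Fin n),
      ∫ y, coordFunction c y ∂(μ : Measure (range rankedProbs)) =
        P.real (Y ⁻¹' cylinderSet c.1 {c.2}) := by
  choose f hf using fun N : ℕ =>
    exists_networkLaw_eq_pi (ProbabilityTheory.uniformOn (univ : Set (Fin (N + 1))))
  have hmeas : ∀ N, Measurable fun ω => rankedEquiv (f N ((Y ω).restrict (N + 1))) :=
    fun N A _ => hY (measurableSet_cylinderSet (N + 1) {E | rankedEquiv (f N E) ∈ A})
  let ν : ℕ → ProbabilityMeasure (range rankedProbs) := fun N =>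
    ⟨P.map fun ω => rankedEquiv (f N ((Y ω).restrict (N + 1))),
      Measure.isProbabilityMeasure_map (hmeas N).aemeasurable⟩
  obtain ⟨μ, hμ⟩ := exists_integral_eq_of_tendsto ν
  refine ⟨μ, fun c => hμ _ _ ((h.tendsto_integral_restrict_pullback hY c.2).congr fun N => ?_)⟩
  simp only [ν, ProbabilityMeasure.coe_mk]
  rw [integral_map (hmeas N).aemeasurable
    (coordFunction c).continuous.measurable.aestronglyMeasurable]
  simp only [coordFunction_rankedEquiv, hf]

theorem exists_mixing_measure {Ω : Type*} [MeasurableSpace Ω] (P : Measure Ω)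
    [IsProbabilityMeasure P] {Y : Ω → Network ℕ} (hY : Measurable Y)
    (hexch : EdgeExchangeable P Y) :
    ∃ φ : Measure RankedSimplex, IsProbabilityMeasure φ ∧
      ∀ B : Set (Network ℕ), MeasurableSet B →
        P (Y ⁻¹' B) = ∫⁻ f : RankedSimplex, networkLaw (f : PairSimplex) B ∂φ := by
  obtain ⟨μ, hμ⟩ := hexch.exists_integral_coordFunction hY
  let φ := (μ : Measure (range rankedProbs)).map rankedEquiv.symm
  have hφ : IsProbabilityMeasure φ :=
    Measure.isProbabilityMeasure_map rankedEquiv.symm.measurable.aemeasurable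
  have hφμ : φ.map rankedEquiv = μ := rankedEquiv.map_map_symm
  let law := φ.bind fun f : RankedSimplex => networkLaw (f : PairSimplex)
  have hlaw : ∀ {B}, MeasurableSet B →
      law B = ∫⁻ f : RankedSimplex, networkLaw (f : PairSimplex) B ∂φ := fun hB =>
    Measure.bind_apply hB measurable_networkLaw.aemeasurable
  have : IsProbabilityMeasure law :=
    isProbabilityMeasure_bind measurable_networkLaw.aemeasurable
      (ae_of_all _ fun _ => inferInstance)
  have := Measure.isProbabilityMeasure_map (μ := P) hY.aemeasurable
  have hmap : P.map Y = law := network_measure_ext fun n E => by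
    have hB := measurableSet_cylinderSet n {E}
    rw [Measure.map_apply hY hB, ← measureReal_eq_measureReal_iff, ← hμ ⟨n, E⟩, ← hφμ,
      integral_map_rankedEquiv hB (coordFunction_rankedEquiv ⟨n, E⟩), ← hlaw hB, measureReal_def]
  exact ⟨φ, hφ, fun B hB => by rw [← Measure.map_apply hY hB, hmap, hlaw hB]⟩

end EdgeExch

theorem theoremA2 {Ω : Type*} [MeasurableSpace Ω] (P : MeasureTheory.Measure Ω)
    [MeasureTheory.IsProbabilityMeasure P] (Y : Ω → EdgeExch.Network ℕ) (hY : Measurable Y)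
    (hexch : EdgeExch.EdgeExchangeable P Y) :
    ∃! φ : MeasureTheory.Measure EdgeExch.RankedSimplex,
      MeasureTheory.IsProbabilityMeasure φ ∧
        ∀ B : Set (EdgeExch.Network ℕ), MeasurableSet B →
          P (Y ⁻¹' B) = ∫⁻ f : EdgeExch.RankedSimplex, EdgeExch.networkLaw (f : EdgeExch.PairSimplex) B ∂φ := by
  obtain ⟨φ, hφ, h⟩ := EdgeExch.exists_mixing_measure P hY hexch
  refine ⟨φ, ⟨hφ, h⟩, ?_⟩
  rintro ψ ⟨hψ, h'⟩
  exact EdgeExch.mixing_measure_unique fun B hB => (h' B hB).symm.trans (h B hB)
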